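/- **Setting.** Let $\mathrm H=\{f\in L^2(\mathbb R): \operatorname{supp} f\subseteq[0,1]\}$ and $\hat f(\omega)=\int f(x)e^{-2\pi i\omega x}\,dx$. For $K>0$ and $0<\delta<1$, a finite nonempty set $\Omega=\{\omega_1<\dots<\omega_N\}\subseteq[-K,K]$ is called *$(K,\delta)$-dense* if $\omega_{n+1}-\omega_n\le\delta$ for $n=0,\dots,N$, where $\omega_0=\omega_N-2K$ and $\omega_{N+1}=\omega_1+2K$. Put $\mu_n=\tfrac12(\omega_{n+1}-\omega_{n-1})$ and $$\mathcal S f=\sum_{n=1}^N\mu_n\hat f(\omega_n)\,e^{2\pi i\omega_n\cdot}\,\mathbb 1_{[0,1]},\qquad f\in\mathrm H .$$ For a finite-dimensional subspace $\mathrm T\subseteq\mathrm H$, the operator $\mathcal S$ is *admissible* for $(\Omega,\mathrm T)$ if it is bounded and linear, $\mathcal Sf$ depends only on $\{\hat f(\omega):\omega\in\Omega\}$, $\mathcal S$ is self-adjoint with $|\langle\mathcal Sf,g\rangle|\le\sqrt{\langle\mathcal Sf,f\rangle\langle\mathcal Sg,g\rangle}$ for all $f,g\in\mathrm H$, and $\langle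 \mathcal Sf,f\rangle\ge C\|f\|^2$ on $\mathrm T$ for some $C>0$. Let $C_1$ be the largest constant with $\langle\mathcal Sf,f\rangle\ge C_1\|f\|^2$ for all $f\in\mathrm T$, let $C_2$ be the smallest constant with $\langle\mathcal Sf,f\rangle\le C_2\|f\|^2$ for all $f\in\mathrm H$, and let $C(\Omega,\mathrm T)=\sqrt{C_2/C_1}$. Let $\phi\in L^2(\mathbb R)$ generate a multiresolution analysis $(V_j)_{j\in\mathbb Z}$ of $L^2(\mathbb R)$, with $\{\phi(\cdot-k)\}_{k\in\mathbb Z}$ a Riesz basis of $V_0$. Assume $\operatorname{supp}\phi\subseteq[-p+1,p]$ with $p\in\mathbb N$. Write $f_{j,k}(x)=2^{j/2}f(2^jx-k)$. All spaces below are regarded as subspaces of $\mathrm H$, that is, every function is multiplied by $\mathbb 1_{[0,1]}$. Consider two kinds of reconstruction spaces. * *Folded wavelets.* Let $f^{\mathrm{fold}}(x)=\sum_{k\in\mathbb Z}f(x-2k)+\sum_{k\in\mathbb Z}f(2k-x)$. Let $\psi$ be a compactly supported function generating a wavelet basis $\{\psi_{j,k}\}$ of $L^2(\mathbb R)$ associated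 with $(V_j)$: the closed span of $\{\psi(\cdot-k)\}_{k\in\mathbb Z}$ is a complement of $V_0$ in $V_1$ (not necessarily the orthogonal one), and $\{\psi_{j,k}\}_{j,k\in\mathbb Z}$ is a Riesz basis of $L^2(\mathbb R)$. For $\iota\in\{0,1\}$, let $V_j^{\mathrm{fold}}=\operatorname{span}\{\phi_{j,k}^{\mathrm{fold}}:0\le k\le 2^j-\iota\}$ and $W_j^{\mathrm{fold}}=\operatorname{span}\{\psi_{j,k}^{\mathrm{fold}}:0\le k\le 2^j-1\}$. (The usual choice is $\iota=0$ for $\psi$ symmetric about $1/2$ and $\iota=1$ for $\psi$ antisymmetric about $1/2$.) For integers $0\le J\le R$, set $\mathrm T=V_J^{\mathrm{fold}}+W_J^{\mathrm{fold}}+\dots+W_{R-1}^{\mathrm{fold}}$. * *Cohen–Daubechies–Vial boundary wavelets.* Let $\phi^{\mathrm{left}}_0,\dots,\phi^{\mathrm{left}}_{p-1}$ be the Gram–Schmidt orthonormalization in $L^2(\mathbb R)$, starting from $k=p-1$ and going down to $k=0$, of the functions $\sum_{n=k}^{2p-2}\binom nk\phi(x+n-p+1)\mathbb 1_{[0,\infty)}(x)$.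 Let $\phi_k^{\mathrm{right}}(x)$ be $\phi_k^{\mathrm{left}}(-x)$ built from $\phi(1-\cdot)$ in place of $\phi$. For $2^j\ge 2p$, let $V^{\mathrm{int}}_j$ be the span of $\phi_{j,k}$ for $p\le k<2^j-p$, of $2^{j/2}\phi_k^{\mathrm{left}}(2^jx)$ for $0\le k<p$, and of $2^{j/2}\phi^{\mathrm{right}}_{2^j-k-1}(2^j(x-1))$ for $2^j-p\le k<2^j$. Let $W_j^{\mathrm{int}}$ be the orthogonal complement of $V_j^{\mathrm{int}}$ in $V_{j+1}^{\mathrm{int}}$, more precisely $V_{j+1}^{\mathrm{int}}\cap(V_j^{\mathrm{int}})^\perp$; for a Daubechies scaling function $\phi$ the boundary wavelets are an orthonormal basis of it. For integers $J\le R$ with $2^J\ge 2p$, set $\mathrm T=V_J^{\mathrm{int}}+W_J^{\mathrm{int}}+\dots+W_{R-1}^{\mathrm{int}}$. **Theorem.** Suppose in addition that, for some $c$ and some $\alpha>\tfrac12$, $$|\hat\phi(\omega)|\le\frac{c}{(1+|\omega|)^{\alpha}},\qquad\omega\in\mathbb R .$$ Let $\mathrm T$ be either (i) the folded or (ii) the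 boundary wavelet reconstruction space at level $R$. Then for every $\epsilon>0$ there is a constant $c_0=c_0(\epsilon)>0$, depending only on $\epsilon$ and the wavelet system (not on $J$, $R$, $K$, $\delta$ or $\Omega$), such that, whenever $\Omega$ is $(K,\delta)$-dense with $\epsilon<1-\delta$ and $K\ge c_0(\epsilon)\,2^R$, the operator $\mathcal S$ is admissible for $(\Omega,\mathrm T)$ and $$C(\Omega,\mathrm T)\le\frac{1+\delta}{1-\delta-\epsilon}.$$ -/

import Mathlib

open MeasureTheory Set
open scoped FourierTransform InnerProductSpace

noncomputable section

namespace NUGS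

/-- The Hilbert space `L²(ℝ)` of complex-valued functions. -/
abbrev L2R : Type := Lp ℂ 2 (volume : Measure ℝ)

/-- The space `H = {f ∈ L²(ℝ) : supp f ⊆ [0,1]}`. -/
def H : Submodule ℂ L2R where
  carrier := {f | ∀ᵐ x : ℝ, x ∉ Icc (0 : ℝ) 1 → f x = 0}
  zero_mem' := by
    filter_upwards [Lp.coeFn_zero ℂ 2 (volume : Measure ℝ)] with x hx _
    rw [hx]; rfl
  add_mem' := by
    intro f g hf hg
    filter_upwards [hf, hg, Lp.coeFn_add f g] with x h1 h2 h3 hx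
    rw [h3, Pi.add_apply, h1 hx, h2 hx, add_zero]
  smul_mem' := by
    intro c f hf
    filter_upwards [hf, Lp.coeFn_smul c f] with x h1 h2 hx
    rw [h2, Pi.smul_apply, h1 hx, smul_zero]

open Classical in
/-- The class in `L²(ℝ)` of a function (used only for square-integrable functions; the value is
`0` otherwise). -/
def toL2 (g : ℝ → ℂ) : L2R :=
  if h : MemLp g 2 (volume : Measure ℝ) then h.toLp g else 0

theorem toL2_indicator_mem (g : ℝ → ℂ) : toL2 ((Icc (0 : ℝ) 1).indicator g) ∈ H := by
  unfold toL2
  split_ifs with h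
  · change ∀ᵐ x : ℝ, _
    filter_upwards [h.coeFn_toLp] with x hx hx'
    rw [hx, indicator_of_notMem hx']
  · exact H.zero_mem

/-- The element `g · 1_[0,1]` of `H`. -/
def toH (g : ℝ → ℂ) : H := ⟨toL2 ((Icc (0 : ℝ) 1).indicator g), toL2_indicator_mem g⟩

/-- The Fourier transform `f̂(ω) = ∫ f(x) e^{-2πiωx} dx` of `f ∈ H` (an absolutely convergent
integral, since `f` is square-integrable with bounded support). -/
def fhat (f : H) (ω : ℝ) : ℂ := 𝓕 (fun x : ℝ => (f : L2R) x) ω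

/-! ### Sampling schemes and the sampling operator -/

/-- For points `ω_1, …, ω_{N+1}` (here `ω 0, …, ω N`), the extended sequence with
`ω_0 = ω_{N+1} - 2K` and `ω_{N+2} = ω_1 + 2K`; entry `n` with `1 ≤ n ≤ N + 1` is the `n`-th
point. -/
def extend {N : ℕ} (K : ℝ) (ω : Fin (N + 1) → ℝ) (n : ℕ) : ℝ :=
  if n = 0 then ω (Fin.last N) - 2 * K
  else if h : n - 1 < N + 1 then ω ⟨n - 1, h⟩
  else ω 0 + 2 * K

/-- `(K, δ)`-density of a sampling scheme. -/
structure IsDense {N : ℕ} (K δ : ℝ) (ω : Fin (N + 1) → ℝ) : Prop where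
  K_pos : 0 < K
  delta_pos : 0 < δ
  delta_lt_one : δ < 1
  strictMono : StrictMono ω
  bandwidth : ∀ i, ω i ∈ Icc (-K) K
  gap : ∀ n ≤ N + 1, extend K ω (n + 1) - extend K ω n ≤ δ

/-- The weights `μ_n = (ω_{n+1} - ω_{n-1}) / 2`. -/
def weight {N : ℕ} (K : ℝ) (ω : Fin (N + 1) → ℝ) (i : Fin (N + 1)) : ℝ :=
  (extend K ω ((i : ℕ) + 2) - extend K ω (i : ℕ)) / 2

/-- The sampling operator `S f = ∑ₙ μₙ f̂(ωₙ) e^{2πiωₙ·} 1_[0,1]` on `H`. -/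
def samplingOp {N : ℕ} (K : ℝ) (ω : Fin (N + 1) → ℝ) (f : H) : H :=
  ∑ i, ((weight K ω i : ℂ) * fhat f (ω i)) •
    toH (fun x => Complex.exp (2 * Real.pi * Complex.I * ω i * x))

/-- `S` is an admissible sampling operator for the pair `(Ω, T)`. -/
structure IsAdmissible {ι : Type*} (ω : ι → ℝ) (S : H → H) (T : Submodule ℂ H) : Prop where
  finite_dim : FiniteDimensional ℂ T
  bounded_linear : IsBoundedLinearMap ℂ S
  depends_on_samples : ∀ f g : H, (∀ i, fhat f (ω i) = fhat g (ω i)) → S f = S g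
  self_adjoint : ∀ f g : H, ⟪S f, g⟫_ℂ = ⟪f, S g⟫_ℂ
  cauchy_schwarz : ∀ f g : H,
    ‖⟪S f, g⟫_ℂ‖ ≤ √((⟪S f, f⟫_ℂ).re * (⟪S g, g⟫_ℂ).re)
  lower_bound : ∃ C : ℝ, 0 < C ∧ ∀ f ∈ T, C * ‖f‖ ^ 2 ≤ (⟪S f, f⟫_ℂ).re

/-- `C₁`: the largest constant with `⟨S f, f⟩ ≥ C₁ ‖f‖²` for all `f ∈ T`. -/
def C₁ (S : H → H) (T : Submodule ℂ H) : ℝ :=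
  sSup {C : ℝ | ∀ f ∈ T, C * ‖f‖ ^ 2 ≤ (⟪S f, f⟫_ℂ).re}

/-- `C₂`: the smallest constant with `⟨S f, f⟩ ≤ C₂ ‖f‖²` for all `f ∈ H`. -/
def C₂ (S : H → H) : ℝ :=
  sInf {C : ℝ | ∀ f : H, (⟪S f, f⟫_ℂ).re ≤ C * ‖f‖ ^ 2}

/-- The reconstruction constant `√(C₂ / C₁)`. -/
def reconConst (S : H → H) (T : Submodule ℂ H) : ℝ := √(C₂ S / C₁ S T)

/-! ### Multiresolution analyses and wavelets -/

/-- `e` is a Riesz basis of the closed subspace `V`. -/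
structure IsRieszBasis {ι : Type*} (e : ι → L2R) (V : Submodule ℂ L2R) : Prop where
  bounds : ∃ d₁ d₂ : ℝ, 0 < d₁ ∧ 0 < d₂ ∧ ∀ a : ι →₀ ℂ,
    d₁ * a.sum (fun _ z => ‖z‖ ^ 2) ≤ ‖a.sum (fun i z => z • e i)‖ ^ 2 ∧
    ‖a.sum (fun i z => z • e i)‖ ^ 2 ≤ d₂ * a.sum (fun _ z => ‖z‖ ^ 2)
  closed_span : (Submodule.span ℂ (range e)).topologicalClosure = V

/-- `f_{j,k}(x) = 2^{j/2} f(2^j x - k)`. -/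
def dyadic (f : ℝ → ℂ) (j k : ℤ) (x : ℝ) : ℂ :=
  (((2 : ℝ) ^ ((j : ℝ) / 2) : ℝ) : ℂ) * f ((2 : ℝ) ^ j * x - k)

/-- `V` is a multiresolution analysis of `L²(ℝ)` generated by the scaling function `φ`. -/
structure IsMRA (V : ℤ → Submodule ℂ L2R) (φ : ℝ → ℂ) : Prop where
  memLp : MemLp φ 2 (volume : Measure ℝ)
  closed : ∀ j, IsClosed (V j : Set L2R)
  mono : Monotone V
  dense : (⨆ j, V j).topologicalClosure = ⊤
  inter : ⨅ j, V j = ⊥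
  dilation : ∀ (j : ℤ) (f g : L2R), (∀ᵐ x : ℝ, g x = f (2 * x)) → (f ∈ V j ↔ g ∈ V (j + 1))
  riesz : IsRieszBasis (fun k : ℤ => toL2 (dyadic φ 0 k)) (V 0)

/-- `ψ` generates a compactly supported wavelet basis `{ψ_{j,k}}` of `L²(ℝ)` associated with the
multiresolution analysis `V`: the integer translates of `ψ` span a closed complement of `V 0` in
`V 1` (not necessarily the orthogonal one), and the `ψ_{j,k}` form a Riesz basis of `L²(ℝ)`. -/
structure IsWavelet (V : ℤ → Submodule ℂ L2R) (ψ : ℝ → ℂ) : Prop where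
  memLp : MemLp ψ 2 (volume : Measure ℝ)
  compact_support : HasCompactSupport ψ
  disjoint : Disjoint (V 0)
    (Submodule.span ℂ (range fun k : ℤ => toL2 (dyadic ψ 0 k))).topologicalClosure
  sup_eq : V 0 ⊔
    (Submodule.span ℂ (range fun k : ℤ => toL2 (dyadic ψ 0 k))).topologicalClosure = V 1
  riesz : IsRieszBasis (fun jk : ℤ × ℤ => toL2 (dyadic ψ jk.1 jk.2)) ⊤

/-! ### Folded wavelets -/

/-- The folding operation `f ↦ ∑ₖ f(x - 2k) + ∑ₖ f(2k - x)`, applied to functions of compact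
support, for which both sums are finite at every point. -/
def fold (f : ℝ → ℂ) (x : ℝ) : ℂ :=
  (∑' k : ℤ, f (x - 2 * k)) + ∑' k : ℤ, f (2 * k - x)

/-- `V_j^fold = span {φ_{j,k}^fold : k = 0, …, 2^j - ι}`. -/
def VFold (φ : ℝ → ℂ) (ι j : ℕ) : Submodule ℂ H :=
  Submodule.span ℂ {f | ∃ k : ℕ, k + ι ≤ 2 ^ j ∧ f = toH (fold (dyadic φ j k))}

/-- `W_j^fold = span {ψ_{j,k}^fold : k = 0, …, 2^j - 1}`. -/
def WFold (ψ : ℝ → ℂ) (j : ℕ) : Submodule ℂ H :=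
  Submodule.span ℂ {f | ∃ k : ℕ, k < 2 ^ j ∧ f = toH (fold (dyadic ψ j k))}

/-- `T = V_J^fold ⊕ W_J^fold ⊕ ⋯ ⊕ W_{R-1}^fold`. -/
def TFold (φ ψ : ℝ → ℂ) (ι J R : ℕ) : Submodule ℂ H :=
  VFold φ ι J ⊔ ⨆ j ∈ Finset.Ico J R, WFold ψ j

/-! ### Boundary wavelets of Cohen, Daubechies and Vial -/

/-- The edge function `∑_{n=k}^{2p-2} (n choose k) φ(x + n - p + 1)`, restricted to `[0, ∞)`. -/
def edge (φ : ℝ → ℂ) (p k : ℕ) (x : ℝ) : ℂ :=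
  (Ici (0 : ℝ)).indicator
    (fun y => ∑ n ∈ Finset.Icc k (2 * p - 2), (n.choose k : ℂ) * φ (y + n - p + 1)) x

/-- The left boundary scaling functions `φ_k^left`, `k = 0, …, p - 1`: the Gram–Schmidt
orthonormalization in `L²(ℝ)` of the edge functions, taken in the order of increasing support
(edge function `p - 1` first, edge function `0` last). -/
def phiLeft (φ : ℝ → ℂ) (p : ℕ) (k : Fin p) (x : ℝ) : ℂ :=
  (InnerProductSpace.gramSchmidtNormed ℂ
    (fun i : Fin p => toL2 (edge φ p (p - 1 - (i : ℕ)))) k : L2R) x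

/-- The right boundary scaling functions, living on `(-∞, 0]`: the mirror images of the left
boundary functions of the reflected scaling function `x ↦ φ(1 - x)`. -/
def phiRight (φ : ℝ → ℂ) (p : ℕ) (k : Fin p) (x : ℝ) : ℂ :=
  phiLeft (fun y => φ (1 - y)) p k (-x)

/-- The boundary-adapted scaling functions `φ_{j,k}^int`, `0 ≤ k < 2^j` (for `2p ≤ 2^j`). -/
def phiInt (φ : ℝ → ℂ) (p j k : ℕ) (x : ℝ) : ℂ :=
  if h : k < p then
    (((2 : ℝ) ^ ((j : ℝ) / 2) : ℝ) : ℂ) * phiLeft φ p ⟨k, h⟩ (2 ^ j * x)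
  else if h' : 2 ^ j - k - 1 < p then
    (((2 : ℝ) ^ ((j : ℝ) / 2) : ℝ) : ℂ) * phiRight φ p ⟨2 ^ j - k - 1, h'⟩ (2 ^ j * (x - 1))
  else dyadic φ j k x

/-- `V_j^int = span {φ_{j,k}^int : k = 0, …, 2^j - 1}`. -/
def VInt (φ : ℝ → ℂ) (p j : ℕ) : Submodule ℂ H :=
  Submodule.span ℂ {f | ∃ k : ℕ, k < 2 ^ j ∧ f = toH (phiInt φ p j k)}

/-- The boundary wavelet space `W_j^int`, the orthogonal complement of `V_j^int` in `V_{j+1}^int`;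
for a Daubechies scaling function the boundary wavelets `ψ_{j,k}^int`, `k = 0, …, 2^j - 1`, are an
orthonormal basis of it. -/
def WInt (φ : ℝ → ℂ) (p j : ℕ) : Submodule ℂ H :=
  VInt φ p (j + 1) ⊓ (VInt φ p j)ᗮ

/-- `T = V_J^int ⊕ W_J^int ⊕ ⋯ ⊕ W_{R-1}^int`. -/
def TInt (φ : ℝ → ℂ) (p J R : ℕ) : Submodule ℂ H :=
  VInt φ p J ⊔ ⨆ j ∈ Finset.Ico J R, WInt φ p j

end NUGS

end

noncomputable section

namespace NUGS

/-! ### A sharp Wirtinger inequality -/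

/-! The quadratic form of the sampling operator is `∑ μₙ |f̂(ωₙ)|²`, a Riemann sum for the energy of
`f̂`. Two independent estimates control it.

Sampling. Cut the frequency axis at the midpoints between consecutive nodes, so that `μₙ` is the
length of the cell around `ωₙ`. Each node is within `δ/2` of the ends of its cell, and the sharp
Wirtinger inequality on the two halves bounds the L² distance from `f̂` to its sample by `δ/π` times
the norm of the derivative. After `f` is recentred on `[-1/2, 1/2]`, that derivative has norm at
most `π‖f‖`, so the distance is at most `δ‖f‖`. Hence the root of the form is at most `(1 + δ)‖f‖`
(`IsDense.samplingOp_le`), and at least `(s - δ)‖f‖` when a fraction `s²` of the energy of `f̂` lies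
in `[-(K - 1/2), K - 1/2]` (`IsDense.le_samplingOp`).

Concentration. On each dyadic interval of length `2^{-R}`, every element of either reconstruction
space is a scaled copy of an element of one finite-dimensional space `E`, spanned by restrictions to
`[0,1]` of translates and reflected translates of `φ` (`IsMRA.TFold_le`, `IsMRA.TInt_le`). By
Parseval on the cosets `ξ + ℤ` and compactness of the unit sphere of `E`, one `M` captures all but
an `ε`-fraction of the coset energy, uniformly in `ξ` (`exists_frequency_bound`). The transform of a
function made of `2^R` cells, sampled on a scaled coset, is the transform of a single element of
`E`, so concentration passes to `[-2^R M, 2^R M]` (`energy_of_cells`).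

With `s = 1 - ε` the two estimates give the ratio `(1 + δ)/(1 - δ - ε)`. No Riesz bounds for the
folded or boundary systems enter. -/

theorem wirtinger_aux {u u' : ℝ → ℂ} (hu : ∀ x, HasDerivAt u (u' x) x) (hu' : Continuous u')
    {L κ : ℝ} (hL : 0 < L) (hκ : 0 < κ) (hκL : κ * L < Real.pi / 2) (h0 : u 0 = 0) :
    κ ^ 2 * ∫ x in (0 : ℝ)..L, ‖u x‖ ^ 2 ≤ ∫ x in (0 : ℝ)..L, ‖u' x‖ ^ 2 := by
  set s : ℝ := Real.pi / 2 - κ * L with hs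
  have hspos : 0 < s := by linarith
  have huc : Continuous u := continuous_iff_continuousAt.2 fun x => (hu x).continuousAt
  have hsin : ∀ x ∈ Icc (0 : ℝ) L, 0 < Real.sin (κ * x + s) := by
    intro x hx
    have h1 : 0 ≤ κ * x := by have := hx.1; positivity
    have h2 : κ * x ≤ κ * L := by gcongr; exact hx.2
    exact Real.sin_pos_of_pos_of_lt_pi (by linarith) (by linarith [Real.pi_pos])
  -- The cotangent solves the Riccati equation `g' = -κ² - g²`, so the derivative of `‖u‖² g` is at
  -- most `‖u'‖² - κ²‖u‖²` after completing a square. The shift `s` makes `g` vanish at `L`, and `s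
  -- > 0` keeps the pole out of `[0, L]`; the other boundary term dies because `u 0 = 0`.
  set g : ℝ → ℝ := fun x => κ * (Real.cos (κ * x + s) / Real.sin (κ * x + s)) with hg
  have hgd : ∀ x ∈ Icc (0 : ℝ) L, HasDerivAt g (-(κ ^ 2) - g x ^ 2) x := by
    intro x hx
    have hl : HasDerivAt (fun x : ℝ => κ * x + s) κ x := by
      simpa using ((hasDerivAt_id x).const_mul κ).add_const s
    have h1 := (hl.cos.div hl.sin (hsin x hx).ne').const_mul κ
    refine h1.congr_deriv ?_
    have hne := (hsin x hx).ne'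
    simp only [hg]
    field_simp
  have hnd : ∀ x, HasDerivAt (fun x => ‖u x‖ ^ 2) (2 * ⟪u x, u' x⟫_ℝ) x := fun x =>
    (hu x).norm_sq
  have hgc : ContinuousOn g (Icc 0 L) := fun x hx => (hgd x hx).continuousAt.continuousWithinAt
  have hint : ∀ f : ℝ → ℝ, ContinuousOn f (Icc 0 L) → IntervalIntegrable f volume 0 L :=
    fun f hf => ContinuousOn.intervalIntegrable (by rwa [uIcc_of_le hL.le])
  have hic : Continuous fun x => ⟪u x, u' x⟫_ℝ := huc.inner hu'
  have c1 : ContinuousOn (fun x => 2 * ⟪u x, u' x⟫_ℝ * g x + ‖u x‖ ^ 2 * (-(κ ^ 2) - g x ^ 2))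
      (Icc 0 L) := by fun_prop
  have ftc : ∫ x in (0 : ℝ)..L, (2 * ⟪u x, u' x⟫_ℝ * g x + ‖u x‖ ^ 2 * (-(κ ^ 2) - g x ^ 2)) =
      ‖u L‖ ^ 2 * g L - ‖u 0‖ ^ 2 * g 0 := by
    refine intervalIntegral.integral_eq_sub_of_hasDerivAt
      (f := fun x => ‖u x‖ ^ 2 * g x) (fun x hx => ?_) (hint _ c1)
    rw [uIcc_of_le hL.le] at hx
    exact (hnd x).mul (hgd x hx)
  have hgL : g L = 0 := by
    have : κ * L + s = Real.pi / 2 := by rw [hs]; ring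
    simp [hg, this]
  rw [hgL, h0] at ftc
  have hpt : ∀ x ∈ Icc (0 : ℝ) L, (2 * ⟪u x, u' x⟫_ℝ * g x + ‖u x‖ ^ 2 * (-(κ ^ 2) - g x ^ 2)) +
      κ ^ 2 * ‖u x‖ ^ 2 ≤ ‖u' x‖ ^ 2 := by
    intro x _
    have h := abs_real_inner_le_norm (u x) (u' x)
    have h2 : 2 * ⟪u x, u' x⟫_ℝ * g x ≤ 2 * (‖u x‖ * ‖u' x‖) * |g x| := by
      calc 2 * ⟪u x, u' x⟫_ℝ * g x ≤ |2 * ⟪u x, u' x⟫_ℝ * g x| := le_abs_self _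
        _ = 2 * |⟪u x, u' x⟫_ℝ| * |g x| := by rw [abs_mul, abs_mul, abs_two]
        _ ≤ _ := by gcongr
    nlinarith [sq_nonneg (‖u' x‖ - |g x| * ‖u x‖), sq_abs (g x)]
  have c2 : ContinuousOn (fun x => κ ^ 2 * ‖u x‖ ^ 2) (Icc 0 L) := by fun_prop
  have hfin := intervalIntegral.integral_mono_on hL.le ((hint _ c1).add (hint _ c2))
    (hint (fun x => ‖u' x‖ ^ 2) (by fun_prop)) hpt
  rw [intervalIntegral.integral_add (hint _ c1) (hint _ c2), ftc,
    intervalIntegral.integral_const_mul] at hfin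
  simpa using hfin

/-- Wirtinger's inequality with the sharp constant `4 L² / π²` on an interval of length `L` for a
function vanishing at the left endpoint. -/
theorem wirtinger {u u' : ℝ → ℂ} (hu : ∀ x, HasDerivAt u (u' x) x) (hu' : Continuous u')
    {L : ℝ} (hL : 0 < L) (h0 : u 0 = 0) :
    Real.pi ^ 2 * ∫ x in (0 : ℝ)..L, ‖u x‖ ^ 2 ≤
      (2 * L) ^ 2 * ∫ x in (0 : ℝ)..L, ‖u' x‖ ^ 2 := by
  -- At the critical value `κ = π/(2L)` the cotangent would be singular at `0`; the sharp constant
  -- is reached as the limit `θ → π`.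
  have key : ∀ θ ∈ Ioo (0 : ℝ) Real.pi, θ ^ 2 * ∫ x in (0 : ℝ)..L, ‖u x‖ ^ 2 ≤
      (2 * L) ^ 2 * ∫ x in (0 : ℝ)..L, ‖u' x‖ ^ 2 := by
    intro θ hθ
    have h := wirtinger_aux hu hu' (κ := θ / (2 * L)) hL (div_pos hθ.1 (by positivity))
      (by have := hθ.2; field_simp; linarith) h0
    rw [div_pow, div_mul_eq_mul_div, div_le_iff₀ (by positivity)] at h
    linarith
  have hcl : Real.pi ∈ closure (Ioo (0 : ℝ) Real.pi) := by
    rw [closure_Ioo Real.pi_pos.ne]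
    exact right_mem_Icc.2 Real.pi_pos.le
  refine le_on_closure (f := fun θ : ℝ => θ ^ 2 * ∫ x in (0 : ℝ)..L, ‖u x‖ ^ 2)
    (g := fun _ => (2 * L) ^ 2 * ∫ x in (0 : ℝ)..L, ‖u' x‖ ^ 2) key ?_ ?_ hcl <;> fun_prop

theorem wirtinger_left {u u' : ℝ → ℂ} (hu : ∀ x, HasDerivAt u (u' x) x) (hu' : Continuous u')
    {a b : ℝ} (hab : a ≤ b) :
    Real.pi ^ 2 * ∫ x in a..b, ‖u x - u a‖ ^ 2 ≤
      (2 * (b - a)) ^ 2 * ∫ x in a..b, ‖u' x‖ ^ 2 := by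
  rcases hab.eq_or_lt with rfl | hlt
  · simp
  have h := wirtinger (u := fun x => u (x + a) - u a) (u' := fun x => u' (x + a))
    (fun x => ((hu (x + a)).comp_add_const x a).sub_const _) (by fun_prop) (sub_pos.2 hlt)
    (by simp)
  rw [intervalIntegral.integral_comp_add_right (fun x => ‖u x - u a‖ ^ 2),
    intervalIntegral.integral_comp_add_right (fun x => ‖u' x‖ ^ 2)] at h
  simpa using h

theorem wirtinger_right {u u' : ℝ → ℂ} (hu : ∀ x, HasDerivAt u (u' x) x) (hu' : Continuous u')
    {a b : ℝ} (hab : a ≤ b) :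
    Real.pi ^ 2 * ∫ x in a..b, ‖u x - u b‖ ^ 2 ≤
      (2 * (b - a)) ^ 2 * ∫ x in a..b, ‖u' x‖ ^ 2 := by
  have h := wirtinger_left (u := fun x => u (-x)) (u' := fun x => -u' (-x))
    (fun x => by simpa [Function.comp_def] using (hu (-x)).scomp x (hasDerivAt_neg x)) (by fun_prop) (neg_le_neg hab)
  simp only [norm_neg, neg_neg] at h
  rw [intervalIntegral.integral_comp_neg (fun x => ‖u x - u b‖ ^ 2),
    intervalIntegral.integral_comp_neg (fun x => ‖u' x‖ ^ 2)] at h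
  convert h using 2 <;> simp
  ring

/-! ### The Fourier transform of functions on the unit interval -/

/-- Lebesgue measure on the unit interval. -/
abbrev unitMeasure : Measure ℝ := volume.restrict (Ioc (0 : ℝ) 1)

/-- The Fourier transform `∫ u(x) e^{-2πiζx} dx` over the unit interval. -/
def unitFourier (u : ℝ → ℂ) (ζ : ℝ) : ℂ :=
  ∫ x, Complex.exp (-(2 * Real.pi * Complex.I * ζ * x)) * u x ∂unitMeasure

theorem ae_mem_Ioo_unitMeasure : ∀ᵐ x ∂unitMeasure, x ∈ Ioo (0 : ℝ) 1 := by
  rw [unitMeasure, ← restrict_Ioo_eq_restrict_Ioc]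
  exact ae_restrict_mem measurableSet_Ioo

theorem norm_exp_neg_two_pi_I (ζ x : ℝ) :
    ‖Complex.exp (-(2 * Real.pi * Complex.I * ζ * x))‖ = 1 := by
  rw [show (-(2 * Real.pi * Complex.I * ζ * x) : ℂ) = ((-(2 * Real.pi * ζ * x) : ℝ) : ℂ) *
    Complex.I by push_cast; ring]
  exact Complex.norm_exp_ofReal_mul_I _

theorem unitFourier_congr {u v : ℝ → ℂ} (h : u =ᵐ[unitMeasure] v) : unitFourier u = unitFourier v := by
  funext ζ
  refine integral_congr_ae ?_
  filter_upwards [h] with x hx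
  rw [hx]

theorem integrable_exp_mul {u : ℝ → ℂ} (hu : Integrable u unitMeasure) (ζ : ℝ) :
    Integrable (fun x : ℝ => Complex.exp (-(2 * Real.pi * Complex.I * ζ * x)) * u x)
      unitMeasure := by
  refine hu.bdd_mul (c := 1) ?_ ?_
  · exact Continuous.aestronglyMeasurable (by fun_prop)
  · exact .of_forall fun x => (norm_exp_neg_two_pi_I ζ x).le

theorem hasDerivAt_unitFourier {u : ℝ → ℂ} (hu : Integrable u unitMeasure) (ζ : ℝ) :
    HasDerivAt (unitFourier u)
      (unitFourier (fun x => -(2 * Real.pi * Complex.I * x) * u x) ζ) ζ := by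
  have hd : ∀ x η : ℝ, HasDerivAt
      (fun η : ℝ => Complex.exp (-(2 * Real.pi * Complex.I * η * x)) * u x)
      (Complex.exp (-(2 * Real.pi * Complex.I * η * x)) *
        (-(2 * Real.pi * Complex.I * x) * u x)) η := by
    intro x η
    have h1 : HasDerivAt (fun η : ℝ => -(2 * Real.pi * Complex.I * η * x))
        (-(2 * Real.pi * Complex.I * x)) η := by
      have := ((hasDerivAt_id η).ofReal_comp).const_mul (-(2 * Real.pi * Complex.I * x))
      simp only [mul_one, id, Complex.ofReal_one] at this
      refine this.congr_of_eventuallyEq (.of_forall fun y => ?_)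
      ring
    refine (h1.cexp.mul_const (u x)).congr_deriv ?_
    ring
  refine (hasDerivAt_integral_of_dominated_loc_of_deriv_le (bound := fun x => 2 * Real.pi * ‖u x‖)
    (F' := fun η x => Complex.exp (-(2 * Real.pi * Complex.I * η * x)) *
        (-(2 * Real.pi * Complex.I * x) * u x))
    Filter.univ_mem (.of_forall fun η => (integrable_exp_mul hu η).aestronglyMeasurable)
    (integrable_exp_mul hu ζ) ?_ ?_ (hu.norm.const_mul _)
    (.of_forall fun x η _ => hd x η)).2
  · exact (Continuous.aestronglyMeasurable (by fun_prop)).mul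
      ((Continuous.aestronglyMeasurable (by fun_prop)).mul hu.aestronglyMeasurable)
  · filter_upwards [ae_mem_Ioo_unitMeasure] with x hx η _
    rw [norm_mul, norm_exp_neg_two_pi_I, one_mul, norm_mul]
    gcongr
    rw [norm_neg, norm_mul, norm_mul, norm_mul, Complex.norm_I, Complex.norm_real,
      Complex.norm_real, Real.norm_of_nonneg Real.pi_pos.le, Real.norm_of_nonneg hx.1.le]
    have := hx.2.le
    have := Real.pi_pos
    simp
    nlinarith

theorem continuous_unitFourier {u : ℝ → ℂ} (hu : Integrable u unitMeasure) :
    Continuous (unitFourier u) :=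
  continuous_iff_continuousAt.2 fun ζ => (hasDerivAt_unitFourier hu ζ).continuousAt

theorem memLp_exp_mul {u : ℝ → ℂ} (hu : MemLp u 2 unitMeasure) (ζ : ℝ) :
    MemLp (fun x : ℝ => Complex.exp (-(2 * Real.pi * Complex.I * ζ * x)) * u x) 2
      unitMeasure := by
  refine hu.of_le ((Continuous.aestronglyMeasurable (by fun_prop)).mul hu.aestronglyMeasurable)
    (.of_forall fun x => ?_)
  rw [norm_mul, norm_exp_neg_two_pi_I, one_mul]

/-- Parseval's identity on the coset `ξ + ℤ` of frequencies. -/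
theorem hasSum_unitFourier {u : ℝ → ℂ} (hu : MemLp u 2 unitMeasure) (ξ : ℝ) :
    HasSum (fun l : ℤ => ‖unitFourier u (ξ + l)‖ ^ 2) (∫ x, ‖u x‖ ^ 2 ∂unitMeasure) := by
  -- The values at `ξ + l` are the Fourier coefficients of the modulated function `e^{-2πiξx} u(x)`,
  -- whose modulus is that of `u`.
  have h := hasSum_sq_fourierCoeffOn zero_lt_one (memLp_exp_mul hu ξ)
  simp only [norm_mul, norm_exp_neg_two_pi_I, one_mul, sub_zero, inv_one, one_smul] at h
  rw [intervalIntegral.integral_of_le zero_le_one] at h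
  convert h using 4 with l
  rw [fourierCoeffOn_eq_integral, intervalIntegral.integral_of_le zero_le_one, unitFourier]
  simp only [sub_zero, div_one, one_smul]
  refine integral_congr_ae (.of_forall fun x => ?_)
  simp only [fourier_coe_apply, smul_eq_mul]
  rw [← mul_assoc, ← Complex.exp_add]
  congr 2
  push_cast
  ring

/-- Cutting into unit intervals and translating each to `[0,1]` turns a frequency integral into an
average over cosets `ξ + ℤ`, where Parseval applies. -/
theorem integral_Ico_eq_sum (g : ℝ → ℝ) (hg : Continuous g) (M : ℕ) :
    ∫ ζ in (-(M : ℝ))..M, g ζ =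
      ∫ ξ in (0 : ℝ)..1, ∑ l ∈ Finset.Ico (-(M : ℤ)) M, g (ξ + l) := by
  rw [intervalIntegral.integral_finsetSum (f := fun (l : ℤ) (ξ : ℝ) => g (ξ + l))
    fun l _ => (by fun_prop : Continuous fun ξ : ℝ => g (ξ + l)).intervalIntegrable _ _]
  have h := intervalIntegral.sum_integral_adjacent_intervals (f := g) (μ := volume)
    (a := fun k : ℕ => -(M : ℝ) + k) (n := 2 * M) fun k _ => hg.intervalIntegrable _ _
  have e1 : -(M : ℝ) + ((0 : ℕ) : ℝ) = -M := by simp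
  have e2 : -(M : ℝ) + ((2 * M : ℕ) : ℝ) = M := by push_cast; ring
  simp only [e1, e2] at h
  rw [← h]
  symm
  refine Finset.sum_bij' (fun l _ => (l + M).toNat) (fun k _ => (k : ℤ) - M) ?_ ?_ ?_ ?_ ?_
  · intro l hl; simp at hl ⊢; omega
  · intro k hk; simp at hk ⊢; omega
  · intro l hl; simp at hl ⊢; omega
  · intro k hk; simp
  · intro l hl
    simp only [Finset.mem_Ico] at hl
    have h0 : (((l + M).toNat : ℕ) : ℝ) = l + M := by
      have : (((l + M).toNat : ℕ) : ℤ) = l + M := Int.toNat_of_nonneg (by omega)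
      exact_mod_cast congrArg (Int.cast : ℤ → ℝ) this
    rw [intervalIntegral.integral_comp_add_right]
    push_cast
    rw [h0]
    congr 1 <;> ring

/-- Bessel's inequality for the Fourier transform of a function on the unit interval. -/
theorem integral_unitFourier_le {u : ℝ → ℂ} (hu : MemLp u 2 unitMeasure) {a b : ℝ} (hab : a ≤ b) :
    ∫ ζ in a..b, ‖unitFourier u ζ‖ ^ 2 ≤ ∫ x, ‖u x‖ ^ 2 ∂unitMeasure := by
  have hc : Continuous fun ζ => ‖unitFourier u ζ‖ ^ 2 :=
    ((continuous_unitFourier (hu.integrable one_le_two)).norm).pow 2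
  obtain ⟨M, hM⟩ := exists_nat_ge (max |a| |b|)
  have hcs : Continuous fun ξ : ℝ =>
      ∑ l ∈ Finset.Ico (-(M : ℤ)) M, ‖unitFourier u (ξ + l)‖ ^ 2 :=
    continuous_finsetSum _ fun l _ => hc.comp (continuous_add_const (l : ℝ))
  have ha : -(M : ℝ) ≤ a := neg_le_of_abs_le ((le_max_left _ _).trans hM)
  have hb : b ≤ M := le_of_abs_le ((le_max_right _ _).trans hM)
  calc ∫ ζ in a..b, ‖unitFourier u ζ‖ ^ 2 ≤ ∫ ζ in (-(M : ℝ))..M, ‖unitFourier u ζ‖ ^ 2 :=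
        intervalIntegral.integral_mono_interval ha hab hb (.of_forall fun _ => by positivity)
          (hc.intervalIntegrable _ _)
    _ = ∫ ξ in (0 : ℝ)..1, ∑ l ∈ Finset.Ico (-(M : ℤ)) M, ‖unitFourier u (ξ + l)‖ ^ 2 :=
        integral_Ico_eq_sum _ hc M
    _ ≤ ∫ ξ in (0 : ℝ)..1, ∫ x, ‖u x‖ ^ 2 ∂unitMeasure := by
        refine intervalIntegral.integral_mono_on zero_le_one
          (hcs.intervalIntegrable _ _) (by simp) fun ξ _ => ?_
        exact sum_le_hasSum _ (fun _ _ => by positivity) (hasSum_unitFourier hu ξ)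
    _ = ∫ x, ‖u x‖ ^ 2 ∂unitMeasure := by simp

/-! ### Weighted point samples of a differentiable function -/

/-- Young's inequality applied to the squared triangle inequality. Keeping `t` free makes the
estimate linear, hence additive over cells; optimising `t` at the end recovers Minkowski's
inequality. -/
theorem norm_sq_le_add_mul (z w : ℂ) {t : ℝ} (ht : 0 < t) :
    ‖z‖ ^ 2 ≤ (1 + t) * ‖w‖ ^ 2 + (1 + 1 / t) * ‖w - z‖ ^ 2 := by
  have h1 : ‖z‖ ≤ ‖w‖ + ‖w - z‖ := by
    simpa using norm_sub_le w (w - z)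
  have h2 : ‖z‖ ^ 2 ≤ (‖w‖ + ‖w - z‖) ^ 2 := by gcongr
  have h3 : 2 * (‖w‖ * ‖w - z‖) ≤ t * ‖w‖ ^ 2 + 1 / t * ‖w - z‖ ^ 2 := by
    have : 0 ≤ (t * ‖w‖ - ‖w - z‖) ^ 2 / t := by positivity
    have e : (t * ‖w‖ - ‖w - z‖) ^ 2 / t =
        t * ‖w‖ ^ 2 + 1 / t * ‖w - z‖ ^ 2 - 2 * (‖w‖ * ‖w - z‖) := by
      field_simp
      ring
    linarith
  nlinarith

/-- Two-sided comparison, with parameter `t`, of the weighted sample `L` and the energy `A`, given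
the energy `B` of the derivative. -/
def SampleBounds (δ t L A B : ℝ) : Prop :=
  L ≤ (1 + t) * A + (1 + 1 / t) * (δ ^ 2 / Real.pi ^ 2) * B ∧
    A ≤ (1 + t) * L + (1 + 1 / t) * (δ ^ 2 / Real.pi ^ 2) * B

theorem SampleBounds.add {δ t L A B L' A' B' : ℝ} (h : SampleBounds δ t L A B)
    (h' : SampleBounds δ t L' A' B') : SampleBounds δ t (L + L') (A + A') (B + B') :=
  ⟨by linarith [h.1, h'.1], by linarith [h.2, h'.2]⟩

theorem SampleBounds.sum {δ t : ℝ} {L A B : ℕ → ℝ} (n : ℕ)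
    (h : ∀ i < n, SampleBounds δ t (L i) (A i) (B i)) :
    SampleBounds δ t (∑ i ∈ Finset.range n, L i) (∑ i ∈ Finset.range n, A i)
      (∑ i ∈ Finset.range n, B i) := by
  induction n with
  | zero => simp [SampleBounds]
  | succ n ih =>
    rw [Finset.sum_range_succ, Finset.sum_range_succ, Finset.sum_range_succ]
    exact (ih fun i hi => h i (hi.trans n.lt_succ_self)).add (h n n.lt_succ_self)

/-- Young's inequality is integrated in both directions between `u` and the constant `w`.
Wirtinger's constant `2(b - a)/π` is at most `δ/π` because a half-cell has length at most `δ/2`. -/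
theorem sampleBounds_of_wirtinger {u u' : ℝ → ℂ} (hu : Continuous u)
    {a b δ t : ℝ} (hab : a ≤ b) (hδ : b - a ≤ δ / 2) (ht : 0 < t) (w : ℂ)
    (hw : Real.pi ^ 2 * ∫ x in a..b, ‖u x - w‖ ^ 2 ≤ (2 * (b - a)) ^ 2 * ∫ x in a..b, ‖u' x‖ ^ 2) :
    SampleBounds δ t ((b - a) * ‖w‖ ^ 2) (∫ x in a..b, ‖u x‖ ^ 2) (∫ x in a..b, ‖u' x‖ ^ 2) := by
  set A := ∫ x in a..b, ‖u x‖ ^ 2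
  set B := ∫ x in a..b, ‖u' x‖ ^ 2
  set D := ∫ x in a..b, ‖u x - w‖ ^ 2
  have hB : 0 ≤ B := intervalIntegral.integral_nonneg hab fun _ _ => by positivity
  have hD : D ≤ δ ^ 2 / Real.pi ^ 2 * B := by
    have h1 : (2 * (b - a)) ^ 2 ≤ δ ^ 2 := by
      have : 2 * (b - a) ≤ δ := by linarith
      have : 0 ≤ b - a := sub_nonneg.2 hab
      gcongr
    have h2 : Real.pi ^ 2 * D ≤ δ ^ 2 * B := hw.trans (by gcongr)
    rw [div_mul_eq_mul_div, le_div_iff₀ (by positivity)]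
    linarith
  have hconst : ∫ _ in a..b, ‖w‖ ^ 2 = (b - a) * ‖w‖ ^ 2 := by simp
  have hiA : IntervalIntegrable (fun x => (1 + t) * ‖u x‖ ^ 2) volume a b :=
    Continuous.intervalIntegrable (by fun_prop) _ _
  have hiA' : IntervalIntegrable (fun x => ‖u x‖ ^ 2) volume a b :=
    Continuous.intervalIntegrable (by fun_prop) _ _
  have hiD : IntervalIntegrable (fun x => (1 + 1 / t) * ‖u x - w‖ ^ 2) volume a b :=
    Continuous.intervalIntegrable (by fun_prop) _ _
  have hiw : IntervalIntegrable (fun _ : ℝ => (1 + t) * ‖w‖ ^ 2) volume a b := by simp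
  have hiw' : IntervalIntegrable (fun _ : ℝ => ‖w‖ ^ 2) volume a b := by simp
  have ht' : 0 ≤ 1 + 1 / t := by positivity
  constructor
  · have h := intervalIntegral.integral_mono_on hab hiw' (hiA.add hiD)
      fun x _ => norm_sq_le_add_mul w (u x) ht
    rw [hconst, intervalIntegral.integral_add hiA hiD, intervalIntegral.integral_const_mul,
      intervalIntegral.integral_const_mul] at h
    nlinarith [mul_le_mul_of_nonneg_left hD ht']
  · have h := intervalIntegral.integral_mono_on hab hiA' (hiw.add hiD)
      fun x _ => by simpa [norm_sub_rev] using norm_sq_le_add_mul (u x) w ht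
    rw [intervalIntegral.integral_add hiw hiD, intervalIntegral.integral_const_mul,
      intervalIntegral.integral_const_mul, hconst] at h
    nlinarith [mul_le_mul_of_nonneg_left hD ht']

theorem sampleBounds_cell {u u' : ℝ → ℂ} (hu : ∀ x, HasDerivAt u (u' x) x) (hu' : Continuous u')
    {a q b δ t : ℝ} (haq : a ≤ q) (hqb : q ≤ b) (h1 : q - a ≤ δ / 2) (h2 : b - q ≤ δ / 2)
    (ht : 0 < t) :
    SampleBounds δ t ((b - a) * ‖u q‖ ^ 2) (∫ x in a..b, ‖u x‖ ^ 2) (∫ x in a..b, ‖u' x‖ ^ 2) := by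
  have huc : Continuous u := continuous_iff_continuousAt.2 fun x => (hu x).continuousAt
  have hi : ∀ v : ℝ → ℂ, Continuous v → ∀ c d : ℝ,
      IntervalIntegrable (fun x => ‖v x‖ ^ 2) volume c d := fun v hv c d =>
    Continuous.intervalIntegrable (by fun_prop) _ _
  have h := (sampleBounds_of_wirtinger huc haq h1 ht (u q) (wirtinger_right hu hu' haq)).add
    (sampleBounds_of_wirtinger huc hqb h2 ht (u q) (wirtinger_left hu hu' hqb))
  rw [intervalIntegral.integral_add_adjacent_intervals (hi u huc a q) (hi u huc q b),
    intervalIntegral.integral_add_adjacent_intervals (hi u' hu' a q) (hi u' hu' q b)] at h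
  convert h using 1
  ring

/-- The cells are bounded by midpoints, so the `i`-th has length `(x (i + 2) - x i) / 2`, exactly
the sampling weight, and consecutive cells abut. -/
theorem sampleBounds_sum {u u' : ℝ → ℂ} (hu : ∀ x, HasDerivAt u (u' x) x) (hu' : Continuous u')
    {x : ℕ → ℝ} {N : ℕ} {δ t : ℝ} (hmono : ∀ n ≤ N + 1, x n ≤ x (n + 1))
    (hgap : ∀ n ≤ N + 1, x (n + 1) - x n ≤ δ) (ht : 0 < t) :
    SampleBounds δ t (∑ i ∈ Finset.range (N + 1), (x (i + 2) - x i) / 2 * ‖u (x (i + 1))‖ ^ 2)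
      (∫ ζ in ((x 0 + x 1) / 2)..((x (N + 1) + x (N + 2)) / 2), ‖u ζ‖ ^ 2)
      (∫ ζ in ((x 0 + x 1) / 2)..((x (N + 1) + x (N + 2)) / 2), ‖u' ζ‖ ^ 2) := by
  have huc : Continuous u := continuous_iff_continuousAt.2 fun x => (hu x).continuousAt
  have hi : ∀ v : ℝ → ℂ, Continuous v → ∀ c d : ℝ,
      IntervalIntegrable (fun x => ‖v x‖ ^ 2) volume c d := fun v hv c d =>
    Continuous.intervalIntegrable (by fun_prop) _ _
  have h := SampleBounds.sum (N + 1)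
    (L := fun i => (x (i + 2) - x i) / 2 * ‖u (x (i + 1))‖ ^ 2)
    (A := fun i => ∫ ζ in ((x i + x (i + 1)) / 2)..((x (i + 1) + x (i + 1 + 1)) / 2), ‖u ζ‖ ^ 2)
    (B := fun i => ∫ ζ in ((x i + x (i + 1)) / 2)..((x (i + 1) + x (i + 1 + 1)) / 2), ‖u' ζ‖ ^ 2)
    (δ := δ) (t := t) fun i hi' => by
      have m1 := hmono i hi'.le
      have m2 := hmono (i + 1) hi'
      have g1 := hgap i hi'.le
      have g2 := hgap (i + 1) hi'
      have := sampleBounds_cell hu hu' (a := (x i + x (i + 1)) / 2) (q := x (i + 1))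
        (b := (x (i + 1) + x (i + 1 + 1)) / 2) (δ := δ) (by linarith) (by linarith) (by linarith)
        (by linarith) ht
      convert this using 1
      ring
  rw [intervalIntegral.sum_integral_adjacent_intervals
      (a := fun i => (x i + x (i + 1)) / 2) fun k _ => hi u huc _ _,
    intervalIntegral.sum_integral_adjacent_intervals
      (a := fun i => (x i + x (i + 1)) / 2) fun k _ => hi u' hu' _ _] at h
  exact h

/-! ### The sampling nodes -/

section Nodes

variable {N : ℕ} {K δ : ℝ} {ω : Fin (N + 1) → ℝ}

theorem extend_succ (i : Fin (N + 1)) : extend K ω ((i : ℕ) + 1) = ω i := by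
  simp [extend]
  omega

theorem extend_zero : extend K ω 0 = ω (Fin.last N) - 2 * K := by simp [extend]

theorem extend_last : extend K ω (N + 2) = ω 0 + 2 * K := by simp [extend]

theorem IsDense.extend_le_succ (h : IsDense K δ ω) {n : ℕ} (hn : n ≤ N + 1) :
    extend K ω n ≤ extend K ω (n + 1) := by
  rcases Nat.eq_zero_or_pos n with rfl | hpos
  · have h1 := (h.bandwidth (Fin.last N)).2
    have h2 := (h.bandwidth 0).1
    have := extend_succ (K := K) (ω := ω) 0
    simp only [Fin.val_zero] at this
    rw [extend_zero, this]
    linarith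
  · obtain ⟨m, rfl⟩ : ∃ m, n = m + 1 := ⟨n - 1, by omega⟩
    have e1 := extend_succ (K := K) (ω := ω) ⟨m, by omega⟩
    simp only at e1
    rcases (Nat.lt_or_ge m N) with hm | hm
    · have e2 := extend_succ (K := K) (ω := ω) ⟨m + 1, by omega⟩
      simp only at e2
      rw [e1, e2]
      exact h.strictMono.monotone (Fin.mk_le_mk.2 (Nat.le_succ m))
    · obtain rfl : m = N := by omega
      rw [e1, extend_last]
      have h1 := (h.bandwidth ⟨m, by omega⟩).2
      have h2 := (h.bandwidth 0).1
      linarith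

theorem IsDense.weight_nonneg (h : IsDense K δ ω) (i : Fin (N + 1)) : 0 ≤ weight K ω i := by
  have h1 := h.extend_le_succ i.2.le
  have h2 := h.extend_le_succ i.2
  rw [weight]
  linarith

theorem IsDense.sum_weight (u : ℝ → ℂ) :
    ∑ i ∈ Finset.range (N + 1),
        (extend K ω (i + 2) - extend K ω i) / 2 * ‖u (extend K ω (i + 1))‖ ^ 2 =
      ∑ i, weight K ω i * ‖u (ω i)‖ ^ 2 := by
  rw [Finset.sum_range]
  simp only [extend_succ, weight]

/-- The cells together cover an interval of length `2K` centred at half the sum of the extreme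
nodes. The wrap-around gap bounds that sum by `δ < 1` in modulus, so at most `1/2` is lost at either
end. -/
theorem IsDense.endpoints (h : IsDense K δ ω) :
    (extend K ω 0 + extend K ω 1) / 2 ≤ -(K - 1 / 2) ∧
      K - 1 / 2 ≤ (extend K ω (N + 1) + extend K ω (N + 2)) / 2 := by
  have g0 := h.gap 0 (by omega)
  have e0 := extend_succ (K := K) (ω := ω) 0
  have e1 := extend_succ (K := K) (ω := ω) (Fin.last N)
  simp only [Fin.val_zero, Fin.val_last, zero_add] at e0 e1
  rw [extend_zero, zero_add, e0] at g0
  rw [extend_zero, extend_last, e0, e1]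
  have := (h.bandwidth 0).1
  have := (h.bandwidth (Fin.last N)).2
  have := h.delta_lt_one
  constructor <;> linarith

end Nodes

/-! ### The Hilbert space `H` -/

theorem memLp_coe (f : H) : MemLp (fun x => (f : L2R) x) 2 (volume : Measure ℝ) :=
  Lp.memLp (f : L2R)

theorem memLp_coe_unit (f : H) : MemLp (fun x => (f : L2R) x) 2 unitMeasure :=
  (memLp_coe f).restrict _

theorem ae_eq_indicator (f : H) :
    (fun x => (f : L2R) x) =ᵐ[volume] (Ioc (0 : ℝ) 1).indicator fun x => (f : L2R) x := by
  have h0 : ∀ᵐ x : ℝ, x ≠ 0 := by simp [ae_iff]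
  filter_upwards [f.2, h0] with x hx hx0
  by_cases h : x ∈ Ioc (0 : ℝ) 1
  · rw [indicator_of_mem h]
  · rw [indicator_of_notMem h]
    exact hx fun h' => h ⟨lt_of_le_of_ne h'.1 hx0.symm, h'.2⟩

theorem inner_eq_integral (f g : H) :
    ⟪f, g⟫_ℂ = ∫ x, starRingEnd ℂ ((f : L2R) x) * (g : L2R) x ∂unitMeasure := by
  rw [Submodule.coe_inner, L2.inner_def, unitMeasure, ← integral_indicator measurableSet_Ioc]
  refine integral_congr_ae ?_
  filter_upwards [ae_eq_indicator g] with x hx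
  rw [hx]
  by_cases h : x ∈ Ioc (0 : ℝ) 1
  · simp [h, mul_comm]
  · simp [h]

theorem norm_sq_eq_integral (f : H) : ‖f‖ ^ 2 = ∫ x, ‖(f : L2R) x‖ ^ 2 ∂unitMeasure := by
  have h := inner_eq_integral f f
  have e : ∀ x, starRingEnd ℂ ((f : L2R) x) * (f : L2R) x = ((‖(f : L2R) x‖ ^ 2 : ℝ) : ℂ) := by
    intro x
    rw [mul_comm, Complex.mul_conj, Complex.normSq_eq_norm_sq]
  simp only [e] at h
  rw [integral_complex_ofReal, inner_self_eq_norm_sq_to_K (𝕜 := ℂ) f] at h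
  exact Complex.ofReal_injective ((Complex.ofReal_pow _ _).trans h)

theorem fhat_eq_unitFourier (f : H) : fhat f = unitFourier fun x => (f : L2R) x := by
  funext ζ
  rw [fhat, Real.fourier_eq', unitFourier, unitMeasure, ← integral_indicator measurableSet_Ioc]
  refine integral_congr_ae ?_
  filter_upwards [ae_eq_indicator f] with x hx
  rw [hx]
  by_cases h : x ∈ Ioc (0 : ℝ) 1
  · simp only [h, indicator_of_mem, smul_eq_mul]
    congr 2
    simp
    ring
  · simp [h]

/-- The complex exponential of frequency `ζ`, as an element of `H`. -/
def expH (ζ : ℝ) : H := toH fun x => Complex.exp (2 * Real.pi * Complex.I * ζ * x)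

theorem coe_toH {g : ℝ → ℂ} (hg : MemLp ((Icc (0 : ℝ) 1).indicator g) 2 (volume : Measure ℝ)) :
    (fun x => ((toH g : H) : L2R) x) =ᵐ[volume] (Icc (0 : ℝ) 1).indicator g := by
  simp only [toH, toL2, dif_pos hg]
  exact hg.coeFn_toLp

/-- Sampling is pairing with an exponential, so the sampling operator is a weighted sum of rank-one
operators; its boundedness and its sesquilinear form are read off from this. -/
theorem inner_expH (ζ : ℝ) (g : H) : ⟪expH ζ, g⟫_ℂ = fhat g ζ := by
  have hm : MemLp ((Icc (0 : ℝ) 1).indicator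
      fun x : ℝ => Complex.exp (2 * Real.pi * Complex.I * ζ * x)) 2 (volume : Measure ℝ) := by
    rw [memLp_indicator_iff_restrict measurableSet_Icc]
    refine MemLp.of_bound (Continuous.aestronglyMeasurable (by fun_prop)) 1 (.of_forall fun x => ?_)
    simpa using (norm_exp_neg_two_pi_I (-ζ) x).le
  rw [inner_eq_integral, fhat_eq_unitFourier, unitFourier]
  refine integral_congr_ae ?_
  filter_upwards [ae_restrict_of_ae (coe_toH hm), ae_mem_Ioo_unitMeasure] with x hx hx'
  rw [expH, hx, indicator_of_mem (Ioo_subset_Icc_self hx'), ← Complex.exp_conj]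
  simp [Complex.conj_ofNat]

theorem continuous_fhat (f : H) : Continuous (fhat f) := by
  rw [fhat_eq_unitFourier]
  exact continuous_unitFourier ((memLp_coe_unit f).integrable one_le_two)

/-! ### Bounds for the sampling operator -/

section Sampling

variable {N : ℕ} {K δ : ℝ} {ω : Fin (N + 1) → ℝ}

theorem samplingOp_eq (f : H) :
    samplingOp K ω f = ∑ i, ((weight K ω i : ℂ) * fhat f (ω i)) • expH (ω i) := rfl

theorem inner_samplingOp (f g : H) : ⟪samplingOp K ω f, g⟫_ℂ =
    ∑ i, (weight K ω i : ℂ) * (starRingEnd ℂ (fhat f (ω i)) * fhat g (ω i)) := by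
  rw [samplingOp_eq, sum_inner]
  refine Finset.sum_congr rfl fun i _ => ?_
  rw [inner_smul_left (expH (ω i)) g, inner_expH]
  simp [mul_assoc]

theorem re_inner_samplingOp (f : H) : (⟪samplingOp K ω f, f⟫_ℂ).re =
    ∑ i, weight K ω i * ‖fhat f (ω i)‖ ^ 2 := by
  rw [inner_samplingOp, Complex.re_sum]
  refine Finset.sum_congr rfl fun i _ => ?_
  rw [mul_comm (starRingEnd ℂ _), Complex.mul_conj, Complex.normSq_eq_norm_sq]
  norm_cast

/-- The samples of `f̂` compared with its energy on the interval covered by the nodes. -/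
theorem IsDense.sampleBounds (h : IsDense K δ ω) (f : H) {t : ℝ} (ht : 0 < t) :
    ∃ A B : ℝ, SampleBounds δ t (⟪samplingOp K ω f, f⟫_ℂ).re A B ∧ A ≤ ‖f‖ ^ 2 ∧
      B ≤ Real.pi ^ 2 * ‖f‖ ^ 2 ∧
      (1 / 2 ≤ K → ∫ ζ in (-(K - 1 / 2))..(K - 1 / 2), ‖fhat f ζ‖ ^ 2 ≤ A) := by
  set v : ℝ → ℂ := fun x => (f : L2R) x with hv
  have hvm : MemLp v 2 unitMeasure := memLp_coe_unit f
  -- Multiplying `f̂` by `e^{πiζ}` recentres `f` on `[-1/2, 1/2]` without changing moduli.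
  -- Differentiation then brings down `πi(1 - 2x)`, of modulus at most `π` rather than `2π`; this
  -- cancels the `π` in Wirtinger's constant.
  set w : ℝ → ℂ := fun x => (Real.pi * Complex.I - 2 * Real.pi * Complex.I * x) * v x with hw
  have hwb : ∀ᵐ x ∂unitMeasure, ‖w x‖ ≤ Real.pi * ‖v x‖ := by
    filter_upwards [ae_mem_Ioo_unitMeasure] with x hx
    rw [hw]
    simp only [norm_mul]
    gcongr
    rw [show (Real.pi * Complex.I - 2 * Real.pi * Complex.I * x : ℂ) =
      ((Real.pi * (1 - 2 * x) : ℝ) : ℂ) * Complex.I by push_cast; ring, norm_mul, Complex.norm_I,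
      mul_one, Complex.norm_real, Real.norm_eq_abs, abs_mul, abs_of_pos Real.pi_pos]
    have : |1 - 2 * x| ≤ 1 := by rw [abs_le]; constructor <;> linarith [hx.1, hx.2]
    nlinarith [Real.pi_pos]
  have hwm : MemLp w 2 unitMeasure := by
    refine (hvm.norm.const_mul Real.pi).of_le
      ((Continuous.aestronglyMeasurable (by fun_prop)).mul hvm.aestronglyMeasurable) ?_
    filter_upwards [hwb] with x hx
    refine hx.trans (le_abs_self _)
  have hvi := hvm.integrable one_le_two
  set G : ℝ → ℂ := fun ζ => Complex.exp (Real.pi * Complex.I * ζ) * unitFourier v ζ with hG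
  set G' : ℝ → ℂ := fun ζ => Complex.exp (Real.pi * Complex.I * ζ) * unitFourier w ζ with hG'
  have hexp : ∀ ζ : ℝ, ‖Complex.exp (Real.pi * Complex.I * ζ)‖ = 1 := fun ζ => by
    rw [show (Real.pi * Complex.I * ζ : ℂ) = ((Real.pi * ζ : ℝ) : ℂ) * Complex.I by
      push_cast; ring]
    exact Complex.norm_exp_ofReal_mul_I _
  have hGn : ∀ ζ, ‖G ζ‖ = ‖unitFourier v ζ‖ := fun ζ => by rw [hG, norm_mul, hexp, one_mul]
  have hGn' : ∀ ζ, ‖G' ζ‖ = ‖unitFourier w ζ‖ := fun ζ => by rw [hG', norm_mul, hexp, one_mul]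
  have hderiv : ∀ ζ, HasDerivAt G (G' ζ) ζ := by
    intro ζ
    have h1 : HasDerivAt (fun η : ℝ => (Real.pi * Complex.I * η : ℂ)) (Real.pi * Complex.I) ζ := by
      simpa using ((hasDerivAt_id ζ).ofReal_comp).const_mul (Real.pi * Complex.I : ℂ)
    refine (h1.cexp.mul (hasDerivAt_unitFourier hvi ζ)).congr_deriv ?_
    have hsum : unitFourier w ζ = Real.pi * Complex.I * unitFourier v ζ +
        unitFourier (fun x => -(2 * Real.pi * Complex.I * x) * v x) ζ := by
      have i1 := (integrable_exp_mul hvi ζ).const_mul (Real.pi * Complex.I : ℂ)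
      have hxm : MemLp (fun x : ℝ => -(2 * Real.pi * Complex.I * x) * v x) 2 unitMeasure := by
        have := hwm.sub (hvm.const_mul (Real.pi * Complex.I : ℂ))
        refine this.ae_eq (.of_forall fun x => ?_)
        simp only [hw, Pi.sub_apply]
        ring
      have i2 := integrable_exp_mul (hxm.integrable one_le_two) ζ
      rw [unitFourier, unitFourier, unitFourier, ← integral_const_mul, ← integral_add i1 i2]
      refine integral_congr_ae (.of_forall fun x => ?_)
      simp only [hw]
      ring
    rw [hG']
    simp only
    rw [hsum]
    ring
  have hcG' : Continuous G' := by
    have := continuous_unitFourier (hwm.integrable one_le_two)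
    fun_prop
  have hb := sampleBounds_sum (x := extend K ω) (N := N) hderiv hcG' (fun n hn => h.extend_le_succ hn) h.gap ht
  rw [IsDense.sum_weight] at hb
  simp only [hGn, hGn'] at hb
  rw [re_inner_samplingOp, fhat_eq_unitFourier, norm_sq_eq_integral]
  have hend := h.endpoints
  have hle : (extend K ω 0 + extend K ω 1) / 2 ≤
      (extend K ω (N + 1) + extend K ω (N + 2)) / 2 := by
    have e0 := extend_succ (K := K) (ω := ω) 0
    have e1 := extend_succ (K := K) (ω := ω) (Fin.last N)
    simp only [Fin.val_zero, Fin.val_last, zero_add] at e0 e1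
    rw [extend_zero, extend_last, e0, e1]
    linarith [h.K_pos]
  refine ⟨_, _, hb, integral_unitFourier_le hvm hle, ?_, fun hK => ?_⟩
  · refine (integral_unitFourier_le hwm hle).trans ?_
    rw [← integral_const_mul]
    refine integral_mono_ae (hwm.integrable_norm_pow two_ne_zero)
      ((hvm.integrable_norm_pow two_ne_zero).const_mul _) ?_
    filter_upwards [hwb] with x hx
    calc ‖w x‖ ^ 2 ≤ (Real.pi * ‖v x‖) ^ 2 := by gcongr
      _ = _ := by rw [mul_pow]
  · refine intervalIntegral.integral_mono_interval hend.1 (by linarith) hend.2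
      (.of_forall fun _ => by positivity) (Continuous.intervalIntegrable ?_ _ _)
    have := continuous_unitFourier hvi
    fun_prop

theorem IsDense.samplingOp_le (h : IsDense K δ ω) (f : H) :
    (⟪samplingOp K ω f, f⟫_ℂ).re ≤ (1 + δ) ^ 2 * ‖f‖ ^ 2 := by
  have hδ := h.delta_pos
  -- The value `t = δ` is the optimal one, turning the bound into the perfect square `(1 + δ)²`.
  obtain ⟨A, B, hb, hA, hB, -⟩ := h.sampleBounds f hδ
  calc (⟪samplingOp K ω f, f⟫_ℂ).re ≤ (1 + δ) * A + (1 + 1 / δ) * (δ ^ 2 / Real.pi ^ 2) * B := hb.1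
    _ ≤ (1 + δ) * ‖f‖ ^ 2 + (1 + 1 / δ) * (δ ^ 2 / Real.pi ^ 2) * (Real.pi ^ 2 * ‖f‖ ^ 2) := by
      gcongr
    _ = (1 + δ) ^ 2 * ‖f‖ ^ 2 := by
      have := Real.pi_pos
      field_simp
      ring

theorem IsDense.le_samplingOp (h : IsDense K δ ω) (hK : 1 / 2 ≤ K) {s : ℝ} (hs : δ < s) (f : H)
    (hf : s ^ 2 * ‖f‖ ^ 2 ≤ ∫ ζ in (-(K - 1 / 2))..(K - 1 / 2), ‖fhat f ζ‖ ^ 2) :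
    (s - δ) ^ 2 * ‖f‖ ^ 2 ≤ (⟪samplingOp K ω f, f⟫_ℂ).re := by
  have hδ := h.delta_pos
  have hsδ : 0 < s - δ := sub_pos.2 hs
  have hs0 : 0 < s := hδ.trans hs
  obtain ⟨A, B, hb, -, hB, hA⟩ := h.sampleBounds f (div_pos hδ hsδ)
  have hA' := hf.trans (hA hK)
  -- The choice `t = δ/(s - δ)` makes the two Young factors `s/(s - δ)` and `s/δ`; the error term
  -- becomes `sδ‖f‖²`, leaving `s² - sδ = s(s - δ)`.
  have e1 : 1 + δ / (s - δ) = s / (s - δ) := by field_simp; ring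
  have e2 : 1 + 1 / (δ / (s - δ)) = s / δ := by field_simp; ring
  have h2 := hb.2
  rw [e1, e2] at h2
  have h3 : s / δ * (δ ^ 2 / Real.pi ^ 2) * B ≤ s * δ * ‖f‖ ^ 2 := by
    calc s / δ * (δ ^ 2 / Real.pi ^ 2) * B ≤
          s / δ * (δ ^ 2 / Real.pi ^ 2) * (Real.pi ^ 2 * ‖f‖ ^ 2) := by gcongr
      _ = s * δ * ‖f‖ ^ 2 := by
        have := Real.pi_pos
        field_simp
  have h4 : s * (s - δ) * ‖f‖ ^ 2 ≤ s / (s - δ) * (⟪samplingOp K ω f, f⟫_ℂ).re := by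
    nlinarith
  rw [div_mul_eq_mul_div, le_div_iff₀ hsδ] at h4
  have h5 : s * ((s - δ) ^ 2 * ‖f‖ ^ 2) ≤ s * (⟪samplingOp K ω f, f⟫_ℂ).re := by
    linarith
  exact le_of_mul_le_mul_left h5 hs0

end Sampling

/-! ### Uniform frequency concentration of a finite-dimensional space -/

/-- Square-integrable functions on the unit interval. -/
abbrev UnitL2 : Type := Lp ℂ 2 unitMeasure

theorem integrable_coe_unitL2 (e : UnitL2) : Integrable (fun x => e x) unitMeasure :=
  (Lp.memLp e).integrable one_le_two

/-- The Fourier transform at the frequency `ζ`, as a linear functional. -/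
def unitFourierLin (ζ : ℝ) : UnitL2 →ₗ[ℂ] ℂ where
  toFun e := unitFourier (fun x => e x) ζ
  map_add' e e' := by
    rw [unitFourier_congr (Lp.coeFn_add e e'), unitFourier, unitFourier, unitFourier,
      ← integral_add (integrable_exp_mul (integrable_coe_unitL2 e) ζ)
        (integrable_exp_mul (integrable_coe_unitL2 e') ζ)]
    refine integral_congr_ae (.of_forall fun x => ?_)
    simp [mul_add]
  map_smul' c e := by
    rw [unitFourier_congr (Lp.coeFn_smul c e), unitFourier, unitFourier, RingHom.id_apply,
      smul_eq_mul, ← integral_const_mul]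
    refine integral_congr_ae (.of_forall fun x => ?_)
    simp only [Pi.smul_apply, smul_eq_mul]
    ring

theorem unitFourierLin_apply (ζ : ℝ) (e : UnitL2) :
    unitFourierLin ζ e = unitFourier (fun x => e x) ζ := rfl

theorem norm_sq_unitL2 (e : UnitL2) : ‖e‖ ^ 2 = ∫ x, ‖e x‖ ^ 2 ∂unitMeasure := by
  have h : ⟪e, e⟫_ℂ = ∫ x, ⟪e x, e x⟫_ℂ ∂unitMeasure := L2.inner_def e e
  have e1 : ∀ x, ⟪e x, e x⟫_ℂ = ((‖e x‖ ^ 2 : ℝ) : ℂ) := by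
    intro x
    rw [inner_self_eq_norm_sq_to_K]
    exact (Complex.ofReal_pow _ _).symm
  simp only [e1] at h
  rw [integral_complex_ofReal, inner_self_eq_norm_sq_to_K (𝕜 := ℂ) e] at h
  exact Complex.ofReal_injective ((Complex.ofReal_pow _ _).trans h)

/-- Expanding in an orthonormal basis of `E` gives a finite sum of products of a continuous
coordinate and a continuous function of frequency. -/
theorem continuous_unitFourierLin (E : Submodule ℂ UnitL2) [FiniteDimensional ℂ E] :
    Continuous fun q : E × ℝ => unitFourierLin q.2 (q.1 : UnitL2) := by
  set b := stdOrthonormalBasis ℂ E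
  have h : (fun q : E × ℝ => unitFourierLin q.2 (q.1 : UnitL2)) =
      fun q => ∑ i, ⟪b i, q.1⟫_ℂ * unitFourier (fun x => (b i : UnitL2) x) q.2 := by
    funext q
    conv_lhs => rw [← b.sum_repr' q.1]
    rw [Submodule.coe_sum, map_sum]
    refine Finset.sum_congr rfl fun i _ => ?_
    rw [Submodule.coe_smul, map_smul, smul_eq_mul, unitFourierLin_apply]
  rw [h]
  refine continuous_finsetSum _ fun i _ => ?_
  have hc := continuous_unitFourier (integrable_coe_unitL2 (b i : UnitL2))
  have hi : Continuous fun q : E × ℝ => ⟪b i, q.1⟫_ℂ :=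
    (innerSL ℂ (b i)).continuous.comp continuous_fst
  exact hi.mul (hc.comp continuous_snd)

/-- Dini's theorem: on the compact set of unit vectors of `E` and `ξ ∈ [0,1]`, the continuous
partial Parseval sums increase to the constant `1`, hence uniformly. Homogeneity extends the bound
from the sphere to all of `E`. -/
theorem exists_frequency_bound (E : Submodule ℂ UnitL2) [FiniteDimensional ℂ E] {ε : ℝ}
    (hε : 0 < ε) : ∃ M : ℕ, ∀ e ∈ E, ∀ ξ ∈ Icc (0 : ℝ) 1, (1 - ε) * ‖e‖ ^ 2 ≤
      ∑ l ∈ Finset.Ico (-(M : ℤ)) M, ‖unitFourierLin (ξ + l) e‖ ^ 2 := by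
  have : ProperSpace E := FiniteDimensional.proper ℂ E
  have hc := continuous_unitFourierLin E
  have hcl : ∀ l : ℤ, Continuous fun q : E × ℝ =>
      ‖unitFourierLin (q.2 + l) (q.1 : UnitL2)‖ ^ 2 := fun l =>
    ((hc.comp (continuous_fst.prodMk (continuous_snd.add_const (l : ℝ)))).norm).pow 2
  have hu := Monotone.tendstoUniformlyOn_of_forall_tendsto
    (F := fun (M : ℕ) (q : E × ℝ) =>
      ∑ l ∈ Finset.Ico (-(M : ℤ)) M, ‖unitFourierLin (q.2 + l) (q.1 : UnitL2)‖ ^ 2)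
    (f := fun q => ‖q.1‖ ^ 2) (s := Metric.sphere (0 : E) 1 ×ˢ Icc (0 : ℝ) 1)
    ((isCompact_sphere _ _).prod isCompact_Icc)
    (fun M => (continuous_finsetSum _ fun l _ => hcl l).continuousOn)
    (fun q _ M M' hM => Finset.sum_le_sum_of_subset_of_nonneg
      (Finset.Ico_subset_Ico (by simpa using hM) (by simpa using hM)) fun _ _ _ => by positivity)
    (by fun_prop) (fun q _ => ?_)
  · rw [Metric.tendstoUniformlyOn_iff] at hu
    obtain ⟨M, hM⟩ := (hu ε hε).exists
    refine ⟨M, fun e he ξ hξ => ?_⟩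
    rcases eq_or_ne e 0 with rfl | hne
    · simp
    have hn : ‖e‖ ≠ 0 := norm_ne_zero_iff.2 hne
    set e' : E := ((‖e‖⁻¹ : ℝ) : ℂ) • ⟨e, he⟩
    have hsph : e' ∈ Metric.sphere (0 : E) 1 := by
      rw [mem_sphere_zero_iff_norm, norm_smul, Complex.norm_real, norm_inv, norm_norm,
        Submodule.coe_norm, inv_mul_cancel₀ hn]
    have h := hM (e', ξ) ⟨hsph, hξ⟩
    rw [mem_sphere_zero_iff_norm] at hsph
    simp only [hsph, one_pow, Real.dist_eq] at h
    have h1 := (abs_lt.1 h).2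
    have hs : ∀ l : ℤ, ‖unitFourierLin (ξ + l) (e' : UnitL2)‖ ^ 2 =
        (‖e‖ ^ 2)⁻¹ * ‖unitFourierLin (ξ + l) e‖ ^ 2 := by
      intro l
      rw [Submodule.coe_smul, map_smul, norm_smul, Complex.norm_real, norm_inv, norm_norm, mul_pow,
        inv_pow]
    simp only [hs, ← Finset.mul_sum] at h1
    have h2 : 1 - ε ≤ (‖e‖ ^ 2)⁻¹ *
        ∑ l ∈ Finset.Ico (-(M : ℤ)) M, ‖unitFourierLin (ξ + l) e‖ ^ 2 := by linarith
    rw [inv_mul_eq_div, le_div_iff₀ (by positivity)] at h2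
    exact h2
  · have h := hasSum_unitFourier (Lp.memLp (q.1 : UnitL2)) q.2
    rw [← norm_sq_unitL2] at h
    exact h.comp Finset.tendsto_Ico_neg

/-! ### Functions that are piecewise in a finite-dimensional space -/

theorem integral_eq_sum_cells {X : Type*} [NormedAddCommGroup X] [NormedSpace ℝ X] {g : ℝ → X}
    (hg : Integrable g unitMeasure) {n : ℕ} (hn : 0 < n) :
    ∫ x, g x ∂unitMeasure =
      (n : ℝ)⁻¹ • ∑ m ∈ Finset.range n, ∫ x, g ((x + m) / n) ∂unitMeasure := by
  have hn' : (n : ℝ) ≠ 0 := by positivity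
  have hgi : IntervalIntegrable g volume 0 1 :=
    (intervalIntegrable_iff_integrableOn_Ioc_of_le zero_le_one).2 hg
  have h := intervalIntegral.sum_integral_adjacent_intervals (f := g) (μ := volume)
    (a := fun k : ℕ => (k : ℝ) / n) (n := n) fun k hk => by
      refine hgi.mono_set ?_
      have h1 : (k : ℝ) / n ≤ ((k + 1 : ℕ) : ℝ) / n := by gcongr; simp
      rw [uIcc_of_le h1, uIcc_of_le zero_le_one]
      refine Icc_subset_Icc (by positivity) ?_
      rw [div_le_one (by positivity)]
      exact_mod_cast hk
  simp only [Nat.cast_zero, zero_div, div_self hn'] at h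
  rw [← intervalIntegral.integral_of_le zero_le_one, ← h, Finset.smul_sum]
  refine Finset.sum_congr rfl fun m _ => ?_
  rw [← intervalIntegral.integral_of_le zero_le_one]
  have := intervalIntegral.integral_comp_div_add (a := 0) (b := 1) (f := g) hn' ((m : ℝ) / n)
  simp only [add_div]
  rw [this, inv_smul_smul₀ hn']
  congr 1
  · simp
  · push_cast; ring

theorem integral_exp_int (k : ℤ) :
    ∫ ξ in (0 : ℝ)..1, Complex.exp (2 * Real.pi * Complex.I * k * ξ) = if k = 0 then 1 else 0 := by
  split_ifs with h
  · simp [h]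
  · have hk : (2 * Real.pi * Complex.I * k : ℂ) ≠ 0 := by
      simp [Real.pi_ne_zero, h]
    rw [integral_exp_mul_complex hk]
    have : Complex.exp (2 * Real.pi * Complex.I * k * (1 : ℝ)) = 1 := by
      rw [Complex.exp_eq_one_iff]
      exact ⟨k, by push_cast; ring⟩
    rw [this]
    simp

/-- Parseval's identity for trigonometric polynomials with coefficients in a Hilbert space. -/
theorem integral_norm_sq_trig {X : Type*} [NormedAddCommGroup X] [InnerProductSpace ℂ X]
    (e : ℕ → X) (n : ℕ) :
    ∫ ξ in (0 : ℝ)..1, ‖∑ m ∈ Finset.range n,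
        Complex.exp (-(2 * Real.pi * Complex.I * ξ * m)) • e m‖ ^ 2 =
      ∑ m ∈ Finset.range n, ‖e m‖ ^ 2 := by
  apply Complex.ofReal_injective
  rw [← intervalIntegral.integral_ofReal]
  have hpt : ∀ ξ : ℝ, ((‖∑ m ∈ Finset.range n,
        Complex.exp (-(2 * Real.pi * Complex.I * ξ * m)) • e m‖ ^ 2 : ℝ) : ℂ) =
      ∑ m ∈ Finset.range n, ∑ k ∈ Finset.range n,
        Complex.exp (2 * Real.pi * Complex.I * ((m - k : ℤ) : ℂ) * ξ) * ⟪e m, e k⟫_ℂ := by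
    intro ξ
    have h0 := inner_self_eq_norm_sq_to_K (𝕜 := ℂ) (∑ m ∈ Finset.range n,
        Complex.exp (-(2 * Real.pi * Complex.I * ξ * m)) • e m)
    rw [Complex.ofReal_pow]
    refine h0.symm.trans ?_
    rw [sum_inner]
    refine Finset.sum_congr rfl fun m _ => ?_
    rw [inner_sum]
    refine Finset.sum_congr rfl fun k _ => ?_
    rw [inner_smul_left, inner_smul_right, ← mul_assoc, ← Complex.exp_conj, ← Complex.exp_add]
    congr 2
    simp [Complex.conj_ofNat]
    ring
  simp only [hpt]
  have hi : ∀ m k : ℕ, IntervalIntegrable (fun ξ : ℝ =>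
      Complex.exp (2 * Real.pi * Complex.I * ((m - k : ℤ) : ℂ) * ξ) * ⟪e m, e k⟫_ℂ)
      volume 0 1 := fun m k => Continuous.intervalIntegrable (by fun_prop) _ _
  rw [intervalIntegral.integral_finsetSum fun m _ =>
    Continuous.intervalIntegrable (by fun_prop) _ _, Complex.ofReal_sum]
  refine Finset.sum_congr rfl fun m hm => ?_
  rw [intervalIntegral.integral_finsetSum fun k _ => hi m k]
  simp only [intervalIntegral.integral_mul_const, integral_exp_int, sub_eq_zero, Nat.cast_inj]
  rw [Finset.sum_eq_single m]
  · rw [if_pos rfl, one_mul, inner_self_eq_norm_sq_to_K]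
    exact (Complex.ofReal_pow _ _).symm
  · intro k _ hk
    rw [if_neg hk.symm, zero_mul]
  · exact fun h => absurd hm h

/-- If every element of `E` has all but an `ε`-fraction of its energy in the frequencies
`[-M, M)`, then functions on `[0,1]` that are, up to scaling, in `E` on each of the `n` intervals
of length `1 / n` have all but an `ε`-fraction of their energy in the frequencies `[-nM, nM]`. -/
theorem energy_of_cells {E : Submodule ℂ UnitL2} {ε : ℝ} {M : ℕ}
    (hM : ∀ e ∈ E, ∀ ξ ∈ Icc (0 : ℝ) 1, (1 - ε) * ‖e‖ ^ 2 ≤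
      ∑ l ∈ Finset.Ico (-(M : ℤ)) M, ‖unitFourierLin (ξ + l) e‖ ^ 2)
    {n : ℕ} (hn : 0 < n) (f : H)
    (hf : ∀ m : ℕ, ∃ e ∈ E, (fun x => (f : L2R) ((x + m) / n)) =ᵐ[unitMeasure] fun x => e x) :
    (1 - ε) * ‖f‖ ^ 2 ≤ ∫ ζ in (-(n * M : ℝ))..(n * M), ‖fhat f ζ‖ ^ 2 := by
  choose e heE he using hf
  have hn' : (n : ℝ) ≠ 0 := by positivity
  have hnC : (n : ℂ) ≠ 0 := by exact_mod_cast hn.ne'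
  have hvm := memLp_coe_unit f
  have hvi := hvm.integrable one_le_two
  have hnorm : ∑ m ∈ Finset.range n, ‖e m‖ ^ 2 = n * ‖f‖ ^ 2 := by
    rw [norm_sq_eq_integral, integral_eq_sum_cells (hvm.integrable_norm_pow two_ne_zero) hn,
      smul_eq_mul, mul_inv_cancel_left₀ hn']
    refine Finset.sum_congr rfl fun m _ => ?_
    rw [norm_sq_unitL2]
    refine integral_congr_ae ?_
    filter_upwards [he m] with x hx
    rw [← hx]
  -- All cells are superposed with phases depending only on `ξ`. The result stays in `E`, so the
  -- hypothesis applies to it at each `ξ`.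
  set h : ℝ → UnitL2 := fun ξ => ∑ m ∈ Finset.range n,
    Complex.exp (-(2 * Real.pi * Complex.I * ξ * m)) • e m with hh
  have hhE : ∀ ξ, h ξ ∈ E := fun ξ => E.sum_mem fun m _ => E.smul_mem _ (heE m)
  -- Translation by cell `m` contributes the phase `e^{-2πi(ξ + l)m}`, from which the integer `l`
  -- drops out; hence one `h ξ` serves the whole coset.
  have hfreq : ∀ (ξ : ℝ) (l : ℤ),
      fhat f (n * (ξ + l)) = (n : ℂ)⁻¹ * unitFourierLin (ξ + l) (h ξ) := by
    intro ξ l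
    rw [fhat_eq_unitFourier, unitFourier, integral_eq_sum_cells (integrable_exp_mul hvi _) hn, hh]
    simp only
    rw [map_sum, Complex.real_smul, Complex.ofReal_inv, Complex.ofReal_natCast]
    congr 1
    refine Finset.sum_congr rfl fun m _ => ?_
    rw [map_smul, unitFourierLin_apply, unitFourier, smul_eq_mul, ← integral_const_mul]
    refine integral_congr_ae ?_
    filter_upwards [he m] with x hx
    rw [hx, ← mul_assoc, ← Complex.exp_add]
    congr 1
    rw [Complex.exp_eq_exp_iff_exists_int]
    refine ⟨-(l * m), ?_⟩
    push_cast
    field_simp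
    ring
  have hc : Continuous fun ζ => ‖fhat f (n * ζ)‖ ^ 2 := by
    have := continuous_fhat f
    fun_prop
  have hscale : ∫ ζ in (-(n * M : ℝ))..(n * M), ‖fhat f ζ‖ ^ 2 =
      n * ∫ ζ in (-(M : ℝ))..M, ‖fhat f (n * ζ)‖ ^ 2 := by
    rw [intervalIntegral.mul_integral_comp_mul_left (f := fun ζ => ‖fhat f ζ‖ ^ 2)]
    congr 1
    ring
  have hcs : Continuous fun ξ : ℝ =>
      ∑ l ∈ Finset.Ico (-(M : ℤ)) M, ‖fhat f (n * (ξ + l))‖ ^ 2 :=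
    continuous_finsetSum _ fun l _ => hc.comp (continuous_add_const (l : ℝ))
  have hch : Continuous h := by
    rw [hh]
    fun_prop
  rw [hscale, integral_Ico_eq_sum _ hc M]
  have hmono : ∫ ξ in (0 : ℝ)..1, ((n : ℝ) ^ 2)⁻¹ * ((1 - ε) * ‖h ξ‖ ^ 2) ≤
      ∫ ξ in (0 : ℝ)..1, ∑ l ∈ Finset.Ico (-(M : ℤ)) M, ‖fhat f (n * (ξ + l))‖ ^ 2 := by
    refine intervalIntegral.integral_mono_on zero_le_one
      (Continuous.intervalIntegrable (by fun_prop) _ _) (hcs.intervalIntegrable _ _) fun ξ hξ => ?_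
    simp only [hfreq, norm_mul, mul_pow, ← Finset.mul_sum, norm_inv, Complex.norm_natCast, inv_pow]
    gcongr
    exact hM _ (hhE ξ) ξ hξ
  rw [intervalIntegral.integral_const_mul, intervalIntegral.integral_const_mul,
    integral_norm_sq_trig, hnorm] at hmono
  calc (1 - ε) * ‖f‖ ^ 2 = n * (((n : ℝ) ^ 2)⁻¹ * ((1 - ε) * (n * ‖f‖ ^ 2))) := by
        field_simp
    _ ≤ _ := by gcongr

/-! ### Affine substitutions -/

theorem map_volume_affine {a : ℝ} (ha : a ≠ 0) (b : ℝ) :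
    Measure.map (fun x : ℝ => a * x + b) volume = ENNReal.ofReal |a⁻¹| • (volume : Measure ℝ) := by
  have h : (fun x : ℝ => a * x + b) = (fun x => x + b) ∘ fun x => a * x := rfl
  rw [h, ← Measure.map_map (measurable_add_const b) (measurable_const_mul a),
    Real.map_volume_mul_left ha, Measure.map_smul, (measurePreserving_add_right volume b).map_eq]

theorem quasiMeasurePreserving_affine {a : ℝ} (ha : a ≠ 0) (b : ℝ) :
    Measure.QuasiMeasurePreserving (fun x : ℝ => a * x + b) volume volume :=
  ⟨by fun_prop, by rw [map_volume_affine ha]; exact Measure.smul_absolutelyContinuous⟩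

theorem memLp_comp_affine {u : ℝ → ℂ} (hu : MemLp u 2 (volume : Measure ℝ)) {a : ℝ} (ha : a ≠ 0)
    (b : ℝ) : MemLp (fun x => u (a * x + b)) 2 (volume : Measure ℝ) := by
  refine MemLp.comp_of_map (f := fun x : ℝ => a * x + b) ?_ (by fun_prop)
  rw [map_volume_affine ha]
  exact hu.smul_measure ENNReal.ofReal_ne_top

/-! ### Piecewise spaces -/

/-- Functions whose class on the unit interval belongs to `E`. -/
def unitRepr (E : Submodule ℂ UnitL2) : Submodule ℂ (ℝ → ℂ) where
  carrier := {u | ∃ e ∈ E, u =ᵐ[unitMeasure] fun x => e x}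
  zero_mem' := ⟨0, E.zero_mem, (Lp.coeFn_zero ℂ 2 unitMeasure).symm⟩
  add_mem' := by
    rintro u v ⟨e, he, hu⟩ ⟨e', he', hv⟩
    exact ⟨e + e', E.add_mem he he', (hu.add hv).trans (Lp.coeFn_add e e').symm⟩
  smul_mem' := by
    rintro c u ⟨e, he, hu⟩
    exact ⟨c • e, E.smul_mem c he, (hu.const_smul c).trans (Lp.coeFn_smul c e).symm⟩

theorem unitRepr_congr {E : Submodule ℂ UnitL2} {u v : ℝ → ℂ} (hu : u ∈ unitRepr E)
    (h : u =ᵐ[unitMeasure] v) : v ∈ unitRepr E := by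
  obtain ⟨e, he, hue⟩ := hu
  exact ⟨e, he, h.symm.trans hue⟩

/-- Functions which on every dyadic interval of length `2^{-R}`, read in either direction, are
scaled copies of elements of `E`. -/
def cellSpace (E : Submodule ℂ UnitL2) (R : ℕ) : Submodule ℂ (ℝ → ℂ) where
  carrier := {u | ∀ m : ℤ, (fun x => u ((x + m) / 2 ^ R)) ∈ unitRepr E ∧
    (fun x => u ((m - x) / 2 ^ R)) ∈ unitRepr E}
  zero_mem' := fun _ => ⟨(unitRepr E).zero_mem, (unitRepr E).zero_mem⟩
  add_mem' := fun hu hv m =>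
    ⟨(unitRepr E).add_mem (hu m).1 (hv m).1, (unitRepr E).add_mem (hu m).2 (hv m).2⟩
  smul_mem' := fun c _ hu m =>
    ⟨(unitRepr E).smul_mem c (hu m).1, (unitRepr E).smul_mem c (hu m).2⟩

section CellSpace

variable {E : Submodule ℂ UnitL2} {R : ℕ} {u v : ℝ → ℂ}

theorem cellSpace_congr (hu : u ∈ cellSpace E R) (h : u =ᵐ[volume] v) : v ∈ cellSpace E R := by
  intro m
  have h2 : ((2 : ℝ) ^ R)⁻¹ ≠ 0 := by positivity
  refine ⟨unitRepr_congr (hu m).1 (ae_restrict_of_ae ?_),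
    unitRepr_congr (hu m).2 (ae_restrict_of_ae ?_)⟩
  · filter_upwards [(quasiMeasurePreserving_affine h2 (m / 2 ^ R)).ae h] with x hx
    rwa [show (x + m) / 2 ^ R = ((2 : ℝ) ^ R)⁻¹ * x + m / 2 ^ R by ring]
  · filter_upwards [(quasiMeasurePreserving_affine (neg_ne_zero.2 h2) (m / 2 ^ R)).ae h] with x hx
    rwa [show (m - x) / 2 ^ R = -((2 : ℝ) ^ R)⁻¹ * x + m / 2 ^ R by ring]

theorem cellSpace_comp_sub (hu : u ∈ cellSpace E R) (a : ℤ) :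
    (fun x => u (x - a)) ∈ cellSpace E R := by
  intro m
  have h := hu (m - a * 2 ^ R)
  push_cast at h
  have e1 : ∀ x : ℝ, (x + m) / 2 ^ R - a = (x + (m - a * 2 ^ R)) / 2 ^ R := fun x => by
    field_simp; ring
  have e2 : ∀ x : ℝ, (m - x) / 2 ^ R - a = ((m - a * 2 ^ R) - x) / 2 ^ R := fun x => by
    field_simp; ring
  simpa only [e1, e2] using h

/-- Reflection in the grid swaps the two reading directions. Folding involves such reflections,
which is why both directions are built into `cellSpace`. -/
theorem cellSpace_comp_reflect (hu : u ∈ cellSpace E R) (a : ℤ) :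
    (fun x => u (a - x)) ∈ cellSpace E R := by
  intro m
  have h := hu (a * 2 ^ R - m)
  push_cast at h
  have e1 : ∀ x : ℝ, a - (x + m) / 2 ^ R = ((a * 2 ^ R - m) - x) / 2 ^ R := fun x => by
    field_simp; ring
  have e2 : ∀ x : ℝ, a - (m - x) / 2 ^ R = (x + (a * 2 ^ R - m)) / 2 ^ R := fun x => by
    field_simp; ring
  simpa only [e1, e2] using h.symm

theorem cellSpace_succ (hu : u ∈ cellSpace E R) : (fun x => u (2 * x)) ∈ cellSpace E (R + 1) := by
  intro m
  have e : ∀ y : ℝ, 2 * (y / 2 ^ (R + 1)) = y / 2 ^ R := fun y => by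
    rw [pow_succ]; field_simp
  simpa only [e] using hu m

/-- Up to cell endpoints `S` is a union of cells, so truncation leaves either `u` or zero on each.
-/
theorem cellSpace_indicator {S : Set ℝ}
    (hS : ∀ m : ℤ, (∀ x ∈ Ioo (0 : ℝ) 1, (x + m) / 2 ^ R ∈ S) ∨
      ∀ x ∈ Ioo (0 : ℝ) 1, (x + m) / 2 ^ R ∉ S)
    (hu : u ∈ cellSpace E R) : S.indicator u ∈ cellSpace E R := by
  intro m
  constructor
  · rcases hS m with h | h
    · refine unitRepr_congr (hu m).1 ?_
      filter_upwards [ae_mem_Ioo_unitMeasure] with x hx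
      rw [indicator_of_mem (h x hx)]
    · refine unitRepr_congr (unitRepr E).zero_mem ?_
      filter_upwards [ae_mem_Ioo_unitMeasure] with x hx
      rw [indicator_of_notMem (h x hx)]
      rfl
  · have e : ∀ x : ℝ, (m - x) / 2 ^ R = ((1 - x) + ((m - 1 : ℤ) : ℝ)) / 2 ^ R := fun x => by
      push_cast; ring
    have hmem : ∀ x ∈ Ioo (0 : ℝ) 1, 1 - x ∈ Ioo (0 : ℝ) 1 := fun x hx =>
      ⟨by linarith [hx.2], by linarith [hx.1]⟩
    rcases hS (m - 1) with h | h
    · refine unitRepr_congr (hu m).2 ?_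
      filter_upwards [ae_mem_Ioo_unitMeasure] with x hx
      rw [indicator_of_mem]
      rw [e]
      exact h _ (hmem x hx)
    · refine unitRepr_congr (unitRepr E).zero_mem ?_
      filter_upwards [ae_mem_Ioo_unitMeasure] with x hx
      rw [indicator_of_notMem]
      · rfl
      · rw [e]
        exact h _ (hmem x hx)

theorem cellSpace_indicator_Ici (hu : u ∈ cellSpace E R) :
    (Ici (0 : ℝ)).indicator u ∈ cellSpace E R := by
  refine cellSpace_indicator (fun m => ?_) hu
  rcases le_or_gt 0 m with h | h
  · left
    intro x hx
    have : (0 : ℝ) ≤ m := by exact_mod_cast h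
    have hx0 := hx.1
    exact mem_Ici.2 (div_nonneg (by linarith) (by positivity))
  · right
    intro x hx
    have : (m : ℝ) ≤ -1 := by exact_mod_cast Int.le_sub_one_of_lt h
    rw [mem_Ici, not_le]
    exact div_neg_of_neg_of_pos (by linarith [hx.2]) (by positivity)

theorem cellSpace_indicator_Iic (hu : u ∈ cellSpace E R) :
    (Iic (1 : ℝ)).indicator u ∈ cellSpace E R := by
  refine cellSpace_indicator (fun m => ?_) hu
  rcases lt_or_ge m (2 ^ R) with h | h
  · left
    intro x hx
    have : (m : ℝ) + 1 ≤ 2 ^ R := by exact_mod_cast h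
    rw [mem_Iic, div_le_one (by positivity)]
    linarith [hx.2]
  · right
    intro x hx
    have : (2 : ℝ) ^ R ≤ m := by exact_mod_cast h
    rw [mem_Iic, not_le, one_lt_div (by positivity)]
    linarith [hx.1]

theorem coe_toH_mem_cellSpace (hu : u ∈ cellSpace E R) :
    (fun x => ((toH u : H) : L2R) x) ∈ cellSpace E R := by
  have hI : (Icc (0 : ℝ) 1).indicator u ∈ cellSpace E R := by
    rw [← Ici_inter_Iic, ← indicator_indicator]
    exact cellSpace_indicator_Ici (cellSpace_indicator_Iic hu)
  by_cases h : MemLp ((Icc (0 : ℝ) 1).indicator u) 2 (volume : Measure ℝ)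
  · exact cellSpace_congr hI (coe_toH h).symm
  -- Without square integrability `toL2` takes its default value `0`, which lies in every cell
  -- space.
  · simp only [toH, toL2, dif_neg h]
    exact cellSpace_congr (cellSpace E R).zero_mem (Lp.coeFn_zero ℂ 2 volume).symm

/-- On `[0,1]` only finitely many shifts meet the bounded support, so folding becomes a finite sum
and stays inside a linear subspace. -/
theorem fold_eq_sum {B : ℕ} (hB : Function.support u ⊆ Icc (-(B : ℝ)) B) {x : ℝ}
    (hx : x ∈ Icc (0 : ℝ) 1) :
    fold u x = ∑ k ∈ Finset.Icc (-(B + 1 : ℤ)) (B + 1), (u (x - 2 * k) + u (2 * k - x)) := by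
  have hk : ∀ k : ℤ, k ∉ Finset.Icc (-(B + 1 : ℤ)) (B + 1) →
      (k : ℝ) < -(B + 1) ∨ (B + 1 : ℝ) < k := by
    intro k hk
    rw [Finset.mem_Icc, not_and_or, not_le, not_le] at hk
    exact hk.imp (fun h => by exact_mod_cast h) (fun h => by exact_mod_cast h)
  have hB0 : (0 : ℝ) ≤ B := B.cast_nonneg
  have hz : ∀ y : ℝ, y < -B ∨ (B : ℝ) < y → u y = 0 := by
    intro y hy
    by_contra hne
    have := hB (Function.mem_support.2 hne)
    rcases hy with h | h <;> linarith [this.1, this.2]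
  rw [fold, Finset.sum_add_distrib]
  congr 1
  · refine tsum_eq_sum fun k hk' => hz _ ?_
    rcases hk k hk' with h | h
    · right; linarith [hx.1]
    · left; linarith [hx.2]
  · refine tsum_eq_sum fun k hk' => hz _ ?_
    rcases hk k hk' with h | h
    · left; linarith [hx.1]
    · right; linarith [hx.2]

theorem coe_toH_fold_mem_cellSpace (hu : u ∈ cellSpace E R) {B : ℕ}
    (hB : Function.support u ⊆ Icc (-(B : ℝ)) B) :
    (fun x => ((toH (fold u) : H) : L2R) x) ∈ cellSpace E R := by
  set v : ℝ → ℂ := ∑ k ∈ Finset.Icc (-(B + 1 : ℤ)) (B + 1),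
    ((fun x => u (x - 2 * k)) + fun x => u (2 * k - x)) with hv
  have hvm : v ∈ cellSpace E R := by
    refine Submodule.sum_mem _ fun k _ => Submodule.add_mem _ ?_ ?_
    · simpa using cellSpace_comp_sub hu (2 * k)
    · simpa using cellSpace_comp_reflect hu (2 * k)
  have he : (Icc (0 : ℝ) 1).indicator (fold u) = (Icc (0 : ℝ) 1).indicator v := by
    refine indicator_congr fun x hx => ?_
    rw [fold_eq_sum hB hx, hv, Finset.sum_apply]
    rfl
  have : toH (fold u) = toH v := by simp only [toH, he]
  rw [this]
  exact coe_toH_mem_cellSpace hvm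

end CellSpace

/-- The elements of `H` that belong to `cellSpace E R`. -/
def cellH (E : Submodule ℂ UnitL2) (R : ℕ) : Submodule ℂ H where
  carrier := {f | (fun x => (f : L2R) x) ∈ cellSpace E R}
  zero_mem' := cellSpace_congr (cellSpace E R).zero_mem (Lp.coeFn_zero ℂ 2 volume).symm
  add_mem' := fun {f g} hf hg =>
    cellSpace_congr ((cellSpace E R).add_mem hf hg) (Lp.coeFn_add (f : L2R) (g : L2R)).symm
  smul_mem' := fun c f hf =>
    cellSpace_congr ((cellSpace E R).smul_mem c hf) (Lp.coeFn_smul c (f : L2R)).symm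

/-! ### The local space of a compactly supported scaling function -/

/-- The span of the restrictions to the unit interval of the integer translates of `φ` and of its
reflection. -/
def localSpan (φ : ℝ → ℂ) : Submodule ℂ UnitL2 :=
  Submodule.span ℂ {e | ∃ k : ℤ, ((fun x => e x) =ᵐ[unitMeasure] fun x => φ (x + k)) ∨
    (fun x => e x) =ᵐ[unitMeasure] fun x => φ (k - x)}

/-- Bounded support leaves finitely many translates that meet the unit interval; each prescribes a
single class, and all others give zero. -/
theorem finiteDimensional_localSpan {φ : ℝ → ℂ} {B : ℕ}
    (hB : Function.support φ ⊆ Icc (-(B : ℝ)) B) : FiniteDimensional ℂ (localSpan φ) := by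
  refine FiniteDimensional.span_of_finite ℂ ?_
  have hsub : ∀ w : ℝ → ℂ, {e : UnitL2 | (fun x => e x) =ᵐ[unitMeasure] w}.Finite := fun w =>
    Set.Subsingleton.finite fun e (he : (fun x => e x) =ᵐ[unitMeasure] w) e'
      (he' : (fun x => e' x) =ᵐ[unitMeasure] w) => Lp.ext (he.trans he'.symm)
  refine Set.Finite.subset (((Finset.Icc (-(B + 1 : ℤ)) (B + 1)).finite_toSet.biUnion fun k _ =>
    (hsub fun x => φ (x + k)).union (hsub fun x => φ (k - x))).union (hsub fun _ => 0)) ?_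
  rintro e ⟨k, hk⟩
  by_cases hkB : k ∈ Finset.Icc (-(B + 1 : ℤ)) (B + 1)
  · left
    exact mem_iUnion₂.2 ⟨k, hkB, hk⟩
  · right
    have hk' : (k : ℝ) < -(B + 1) ∨ (B + 1 : ℝ) < k := by
      rw [Finset.mem_Icc, not_and_or, not_le, not_le] at hkB
      exact hkB.imp (fun h => by exact_mod_cast h) (fun h => by exact_mod_cast h)
    have hz : ∀ y : ℝ, y < -B ∨ (B : ℝ) < y → φ y = 0 := by
      intro y hy
      by_contra hne
      have := hB (Function.mem_support.2 hne)
      rcases hy with h | h <;> linarith [this.1, this.2]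
    have hB0 : (0 : ℝ) ≤ B := B.cast_nonneg
    rcases hk with hk | hk
    · refine hk.trans ?_
      filter_upwards [ae_mem_Ioo_unitMeasure] with x hx
      refine hz _ ?_
      rcases hk' with h | h
      · left; linarith [hx.2]
      · right; linarith [hx.1]
    · refine hk.trans ?_
      filter_upwards [ae_mem_Ioo_unitMeasure] with x hx
      refine hz _ ?_
      rcases hk' with h | h
      · left; linarith [hx.1]
      · right; linarith [hx.2]

/-- Composition with a measure preserving map followed by restriction to the unit interval. -/
def compRestrict {τ : ℝ → ℝ} (hτ : MeasurePreserving τ volume volume) : L2R →L[ℂ] UnitL2 :=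
  (LpToLpRestrictCLM ℝ ℂ ℂ volume 2 (Ioc (0 : ℝ) 1)).comp
    (Lp.compMeasurePreservingₗᵢ ℂ τ hτ).toContinuousLinearMap

theorem coe_compRestrict {τ : ℝ → ℝ} (hτ : MeasurePreserving τ volume volume) (f : L2R) :
    (fun x => compRestrict hτ f x) =ᵐ[unitMeasure] fun x => f (τ x) :=
  (LpToLpRestrictCLM_coeFn ℂ (Ioc (0 : ℝ) 1) (Lp.compMeasurePreservingₗᵢ ℂ τ hτ f)).trans
    (ae_restrict_of_ae (Lp.coeFn_compMeasurePreserving f hτ))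

theorem coe_toL2 {g : ℝ → ℂ} (hg : MemLp g 2 (volume : Measure ℝ)) :
    (fun x => toL2 g x) =ᵐ[volume] g := by
  rw [toL2, dif_pos hg]
  exact hg.coeFn_toLp

theorem memLp_dyadic {f : ℝ → ℂ} (hf : MemLp f 2 (volume : Measure ℝ)) (j k : ℤ) :
    MemLp (dyadic f j k) 2 (volume : Measure ℝ) := by
  have h := memLp_comp_affine hf (zpow_ne_zero j (two_ne_zero : (2 : ℝ) ≠ 0)) (-k)
  simp only [← sub_eq_add_neg] at h
  exact h.const_mul _

theorem dyadic_zero (f : ℝ → ℂ) (k : ℤ) : dyadic f 0 k = fun x => f (x - k) := by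
  funext x
  simp [dyadic]

theorem dyadic_succ (f : ℝ → ℂ) (j k : ℤ) (x : ℝ) :
    dyadic f (j + 1) k x = (((2 : ℝ) ^ ((1 : ℝ) / 2) : ℝ) : ℂ) * dyadic f j k (2 * x) := by
  rw [dyadic, dyadic, ← mul_assoc, ← Complex.ofReal_mul, ← Real.rpow_add two_pos,
    zpow_add_one₀ two_ne_zero, mul_assoc]
  congr 4
  push_cast
  ring

section MRA

variable {V : ℤ → Submodule ℂ L2R} {φ : ℝ → ℂ}

/-- The starting level `i` is a parameter so that the scaling function (`i = 0`) and the wavelet (`i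
= 1`) are treated together. -/
theorem IsMRA.dyadic_mem (hV : IsMRA V φ) {f : ℝ → ℂ} (hf : MemLp f 2 (volume : Measure ℝ)) {i : ℤ}
    (h0 : ∀ k : ℤ, toL2 (dyadic f 0 k) ∈ V i) (j : ℕ) (k : ℤ) : toL2 (dyadic f j k) ∈ V (i + j) := by
  induction j with
  | zero => simpa using h0 k
  | succ j ih =>
    have hs := (V (i + j)).smul_mem (((2 : ℝ) ^ ((1 : ℝ) / 2) : ℝ) : ℂ) ih
    rw [Nat.cast_succ, ← add_assoc]
    refine (hV.dilation _ _ _ ?_).1 hs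
    have h2 := (quasiMeasurePreserving_affine (two_ne_zero : (2 : ℝ) ≠ 0) 0).ae
      ((Lp.coeFn_smul (((2 : ℝ) ^ ((1 : ℝ) / 2) : ℝ) : ℂ) (toL2 (dyadic f j k))).and
        (coe_toL2 (memLp_dyadic hf j k)))
    filter_upwards [h2, coe_toL2 (memLp_dyadic hf (j + 1) k)] with x hx hx'
    rw [add_zero] at hx
    rw [hx', dyadic_succ, hx.1, Pi.smul_apply, hx.2, smul_eq_mul]

/-- Restriction to a cell is continuous and sends translates of `φ` into `localSpan φ`. A
finite-dimensional space is closed, so the closed span `V 0` is sent there too. -/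
theorem IsMRA.mem_cellSpace_zero (hV : IsMRA V φ) {f : L2R} (hf : f ∈ V 0)
    [FiniteDimensional ℂ (localSpan φ)] : (fun x => f x) ∈ cellSpace (localSpan φ) 0 := by
  have hcl : IsClosed (localSpan φ : Set UnitL2) := Submodule.closed_of_finiteDimensional _
  have key : ∀ {τ : ℝ → ℝ} (hτ : MeasurePreserving τ volume volume),
      (∀ k : ℤ, ∃ l : ℤ, (∀ x, τ x - k = x + l) ∨ (∀ x, τ x - k = l - x)) →
      compRestrict hτ f ∈ localSpan φ := by
    intro τ hτ hl
    rw [← hV.riesz.closed_span] at hf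
    have hle : (Submodule.span ℂ (range fun k : ℤ => toL2 (dyadic φ 0 k))).topologicalClosure ≤
        (localSpan φ).comap (compRestrict hτ).toLinearMap := by
      refine Submodule.topologicalClosure_minimal _ ?_ (hcl.preimage (compRestrict hτ).continuous)
      rw [Submodule.span_le]
      rintro _ ⟨k, rfl⟩
      obtain ⟨l, hl⟩ := hl k
      refine Submodule.subset_span ⟨l, ?_⟩
      have h1 : (fun x => compRestrict hτ (toL2 (dyadic φ 0 k)) x) =ᵐ[unitMeasure]
          fun x => φ (τ x - k) := by
        refine (coe_compRestrict hτ _).trans (ae_restrict_of_ae ?_)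
        have := hτ.quasiMeasurePreserving.ae (coe_toL2 (memLp_dyadic hV.memLp 0 k))
        rw [dyadic_zero] at this ⊢
        exact this
      refine hl.imp (fun h => ?_) fun h => ?_
      · simp only [h] at h1
        exact h1
      · simp only [h] at h1
        exact h1
    exact hle hf
  intro m
  simp only [pow_zero, div_one]
  constructor
  · exact ⟨_, key (measurePreserving_add_right volume (m : ℝ)) fun k =>
      ⟨m - k, Or.inl fun x => by push_cast; ring⟩, (coe_compRestrict _ f).symm⟩
  · exact ⟨_, key (volume.measurePreserving_sub_left (m : ℝ)) fun k =>
      ⟨m - k, Or.inr fun x => by push_cast; ring⟩, (coe_compRestrict _ f).symm⟩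

theorem IsMRA.mem_cellSpace (hV : IsMRA V φ) [FiniteDimensional ℂ (localSpan φ)] (R : ℕ) {f : L2R}
    (hf : f ∈ V R) : (fun x => f x) ∈ cellSpace (localSpan φ) R := by
  induction R generalizing f with
  | zero => exact hV.mem_cellSpace_zero hf
  | succ R ih =>
    have hm := memLp_comp_affine (Lp.memLp f) (inv_ne_zero (two_ne_zero : (2 : ℝ) ≠ 0)) 0
    have hd : ∀ᵐ x : ℝ, f x = (toL2 fun x => f (2⁻¹ * x + 0)) (2 * x) := by
      filter_upwards [(quasiMeasurePreserving_affine (two_ne_zero : (2 : ℝ) ≠ 0) 0).ae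
        (coe_toL2 hm)] with x hx
      rw [add_zero] at hx
      rw [hx, add_zero, inv_mul_cancel_left₀ two_ne_zero]
    rw [Nat.cast_succ] at hf
    have := ih ((hV.dilation R _ f hd).2 hf)
    refine cellSpace_congr (cellSpace_succ this) ?_
    filter_upwards [hd] with x hx using hx.symm

theorem IsMRA.dyadic_mem_cellSpace (hV : IsMRA V φ) [FiniteDimensional ℂ (localSpan φ)]
    {f : ℝ → ℂ} (hf : MemLp f 2 (volume : Measure ℝ)) {i : ℕ}
    (h0 : ∀ k : ℤ, toL2 (dyadic f 0 k) ∈ V i) {j R : ℕ} (hj : i + j ≤ R) (k : ℤ) :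
    dyadic f j k ∈ cellSpace (localSpan φ) R := by
  have h1 := hV.dyadic_mem hf h0 j k
  have h2 : toL2 (dyadic f j k) ∈ V R := hV.mono (by exact_mod_cast hj) h1
  exact cellSpace_congr (hV.mem_cellSpace R h2) (coe_toL2 (memLp_dyadic hf j k))

theorem IsMRA.scaling_mem (hV : IsMRA V φ) (k : ℤ) : toL2 (dyadic φ 0 k) ∈ V ((0 : ℕ) : ℤ) := by
  rw [Nat.cast_zero, ← hV.riesz.closed_span]
  exact Submodule.le_topologicalClosure _ (Submodule.subset_span ⟨k, rfl⟩)

theorem IsWavelet.wavelet_mem {ψ : ℝ → ℂ} (hψ : IsWavelet V ψ) (k : ℤ) :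
    toL2 (dyadic ψ 0 k) ∈ V ((1 : ℕ) : ℤ) := by
  rw [Nat.cast_one, ← hψ.sup_eq]
  exact Submodule.mem_sup_right
    (Submodule.le_topologicalClosure _ (Submodule.subset_span ⟨k, rfl⟩))

/-! ### Folded reconstruction spaces -/

theorem support_dyadic {f : ℝ → ℂ} {A : ℕ} (hA : Function.support f ⊆ Icc (-(A : ℝ)) A) (j k : ℕ) :
    Function.support (dyadic f j k) ⊆ Icc (-((A + k : ℕ) : ℝ)) ((A + k : ℕ) : ℝ) := by
  intro x hx
  have h : f ((2 : ℝ) ^ (j : ℤ) * x - (k : ℤ)) ≠ 0 := by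
    intro h0
    exact hx (by rw [dyadic, h0, mul_zero])
  have h2 := hA (Function.mem_support.2 h)
  rw [zpow_natCast, Int.cast_natCast] at h2
  have h1 : (1 : ℝ) ≤ 2 ^ j := one_le_pow₀ one_le_two
  have hA0 : (0 : ℝ) ≤ A := A.cast_nonneg
  have hk0 : (0 : ℝ) ≤ k := k.cast_nonneg
  push_cast
  have hle : |x| ≤ |(2 : ℝ) ^ j * x| := by
    rw [abs_mul, abs_of_pos (by positivity : (0 : ℝ) < 2 ^ j)]
    exact le_mul_of_one_le_left (abs_nonneg x) h1
  have : |(2 : ℝ) ^ j * x| ≤ A + k := abs_le.2 ⟨by linarith [h2.1], by linarith [h2.2]⟩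
  exact abs_le.1 (hle.trans this)

/-- The wavelet is used only through its translates lying in `V 1`: at levels `j < R` its dilates
are then in `V (j + 1)`, inside `V R`. -/
theorem IsMRA.TFold_le (hV : IsMRA V φ) [FiniteDimensional ℂ (localSpan φ)] {A : ℕ}
    (hA : Function.support φ ⊆ Icc (-(A : ℝ)) A) {ψ : ℝ → ℂ} (hψ : IsWavelet V ψ) (ι : ℕ)
    {J R : ℕ} (hJR : J ≤ R) : TFold φ ψ ι J R ≤ cellH (localSpan φ) R := by
  obtain ⟨r, hr⟩ := hψ.compact_support.isCompact.isBounded.subset_closedBall 0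
  obtain ⟨B, hB⟩ := exists_nat_ge r
  have hBs : Function.support ψ ⊆ Icc (-(B : ℝ)) B := by
    intro x hx
    have := hr (subset_tsupport ψ hx)
    rw [Metric.mem_closedBall, dist_zero_right, Real.norm_eq_abs] at this
    exact abs_le.1 (this.trans hB)
  refine sup_le ?_ (iSup₂_le fun j hj => ?_)
  · refine Submodule.span_le.2 ?_
    rintro _ ⟨k, -, rfl⟩
    exact coe_toH_fold_mem_cellSpace
      (hV.dyadic_mem_cellSpace hV.memLp hV.scaling_mem (by omega) k) (support_dyadic hA J k)
  · refine Submodule.span_le.2 ?_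
    rintro _ ⟨k, -, rfl⟩
    rw [Finset.mem_Ico] at hj
    exact coe_toH_fold_mem_cellSpace
      (hV.dyadic_mem_cellSpace hψ.memLp hψ.wavelet_mem (by omega) k) (support_dyadic hBs j k)

theorem finiteDimensional_VFold (φ : ℝ → ℂ) (ι j : ℕ) : FiniteDimensional ℂ (VFold φ ι j) := by
  refine FiniteDimensional.span_of_finite ℂ
    (((Finset.range (2 ^ j + 1)).finite_toSet.image fun k : ℕ =>
      toH (fold (dyadic φ j k))).subset ?_)
  rintro _ ⟨k, hk, rfl⟩
  exact ⟨k, by simp; omega, rfl⟩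

theorem finiteDimensional_WFold (ψ : ℝ → ℂ) (j : ℕ) : FiniteDimensional ℂ (WFold ψ j) := by
  refine FiniteDimensional.span_of_finite ℂ
    (((Finset.range (2 ^ j)).finite_toSet.image fun k : ℕ => toH (fold (dyadic ψ j k))).subset ?_)
  rintro _ ⟨k, hk, rfl⟩
  exact ⟨k, by simpa using hk, rfl⟩

theorem finiteDimensional_TFold (φ ψ : ℝ → ℂ) (ι J R : ℕ) :
    FiniteDimensional ℂ (TFold φ ψ ι J R) := by
  have := finiteDimensional_VFold φ ι J
  have := finiteDimensional_WFold ψ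
  rw [TFold, ← Finset.sup_eq_iSup]
  infer_instance

/-! ### Boundary reconstruction spaces -/

theorem IsMRA.translate_mem_cellSpace (hV : IsMRA V φ) [FiniteDimensional ℂ (localSpan φ)]
    {j R : ℕ} (hj : j ≤ R) (l : ℤ) :
    (fun x => φ (2 ^ j * x + l)) ∈ cellSpace (localSpan φ) R := by
  have h := hV.dyadic_mem_cellSpace hV.memLp hV.scaling_mem (by omega : 0 + j ≤ R) (-l)
  have hne : (((2 : ℝ) ^ (((j : ℤ) : ℝ) / 2) : ℝ) : ℂ) ≠ 0 :=
    Complex.ofReal_ne_zero.2 (by positivity)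
  have h2 := (cellSpace (localSpan φ) R).smul_mem
    (((2 : ℝ) ^ (((j : ℤ) : ℝ) / 2) : ℝ) : ℂ)⁻¹ h
  convert h2 using 1
  funext x
  rw [Pi.smul_apply, smul_eq_mul, dyadic, inv_mul_cancel_left₀ hne, zpow_natCast]
  congr 1
  push_cast
  ring

/-- Gram–Schmidt stays within the span of the edge functions; orthonormality plays no role.
Quasi-measure preservation lets almost everywhere identities be pulled back along `τ`. -/
theorem phiLeft_comp_mem_cellSpace {E : Submodule ℂ UnitL2} {R p : ℕ} {f : ℝ → ℂ} {τ : ℝ → ℝ}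
    (hτ : Measure.QuasiMeasurePreserving τ volume volume)
    (h : ∀ i, (fun x => edge f p i (τ x)) ∈ cellSpace E R) (k : Fin p) :
    (fun x => phiLeft f p k (τ x)) ∈ cellSpace E R := by
  set v : Fin p → L2R := fun i => toL2 (edge f p (p - 1 - (i : ℕ)))
  have hspan : ∀ w ∈ Submodule.span ℂ (range v), (fun x => w (τ x)) ∈ cellSpace E R := by
    intro w hw
    induction hw using Submodule.span_induction with
    | mem w hw =>
      obtain ⟨i, rfl⟩ := hw
      by_cases hm : MemLp (edge f p (p - 1 - (i : ℕ))) 2 (volume : Measure ℝ)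
      · exact cellSpace_congr (h _) (hτ.ae (coe_toL2 hm) |>.mono fun x hx => hx.symm)
      · simp only [v, toL2, dif_neg hm]
        exact cellSpace_congr (cellSpace E R).zero_mem
          (hτ.ae (Lp.coeFn_zero ℂ 2 volume) |>.mono fun x hx => hx.symm)
    | zero =>
      exact cellSpace_congr (cellSpace E R).zero_mem
        (hτ.ae (Lp.coeFn_zero ℂ 2 volume) |>.mono fun x hx => hx.symm)
    | add w w' _ _ hw hw' =>
      exact cellSpace_congr ((cellSpace E R).add_mem hw hw')
        (hτ.ae (Lp.coeFn_add w w') |>.mono fun x hx => hx.symm)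
    | smul c w _ hw =>
      exact cellSpace_congr ((cellSpace E R).smul_mem c hw)
        (hτ.ae (Lp.coeFn_smul c w) |>.mono fun x hx => hx.symm)
  refine hspan _ ?_
  rw [InnerProductSpace.gramSchmidtNormed]
  exact Submodule.smul_mem _ _ (Submodule.span_mono (image_subset_range _ _)
    (InnerProductSpace.gramSchmidt_mem_span ℂ v le_rfl))

/-- Besides translates of `f`, an edge function contains a truncation at `0`; `hτ` expresses that
its pullback cuts along grid points. -/
theorem edge_comp_mem_cellSpace {E : Submodule ℂ UnitL2} {R p : ℕ} {f : ℝ → ℂ} {τ : ℝ → ℝ}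
    (hτ : ∀ u ∈ cellSpace E R, (τ ⁻¹' Ici 0).indicator u ∈ cellSpace E R)
    (h : ∀ l : ℤ, (fun x => f (τ x + l)) ∈ cellSpace E R) (i : ℕ) :
    (fun x => edge f p i (τ x)) ∈ cellSpace E R := by
  have hs : (∑ n ∈ Finset.Icc i (2 * p - 2), (n.choose i : ℂ) •
      fun x => f (τ x + ((n - p + 1 : ℤ) : ℝ))) ∈ cellSpace E R :=
    Submodule.sum_mem _ fun n _ => Submodule.smul_mem _ _ (h _)
  refine (congrArg (· ∈ cellSpace E R) ?_).mp (hτ _ hs)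
  funext x
  by_cases hx : 0 ≤ τ x
  · rw [indicator_of_mem (by exact hx), edge, indicator_of_mem (by exact hx), Finset.sum_apply]
    refine Finset.sum_congr rfl fun n _ => ?_
    simp only [Pi.smul_apply, smul_eq_mul]
    congr 2
    push_cast
    ring
  · rw [indicator_of_notMem (by exact hx), edge, indicator_of_notMem (by exact hx)]

theorem IsMRA.phiInt_mem_cellSpace (hV : IsMRA V φ) [FiniteDimensional ℂ (localSpan φ)] (p : ℕ)
    {j R : ℕ} (hj : j ≤ R) (k : ℕ) : phiInt φ p j k ∈ cellSpace (localSpan φ) R := by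
  have h2 : (2 : ℝ) ^ j ≠ 0 := by positivity
  have h2' : (0 : ℝ) < 2 ^ j := by positivity
  by_cases hk : k < p
  · have hL : (fun x => phiLeft φ p ⟨k, hk⟩ (2 ^ j * x + 0)) ∈ cellSpace (localSpan φ) R := by
      refine phiLeft_comp_mem_cellSpace (quasiMeasurePreserving_affine h2 0) (fun i => ?_) _
      refine edge_comp_mem_cellSpace (fun u hu => ?_) (fun l => ?_) i
      · rw [show (fun x : ℝ => 2 ^ j * x + 0) ⁻¹' Ici 0 = Ici 0 by
          ext x; simp]
        exact cellSpace_indicator_Ici hu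
      · simpa only [add_zero] using hV.translate_mem_cellSpace hj l
    refine (congrArg (· ∈ cellSpace (localSpan φ) R) ?_).mp
      ((cellSpace (localSpan φ) R).smul_mem (((2 : ℝ) ^ ((j : ℝ) / 2) : ℝ) : ℂ) hL)
    funext x
    rw [phiInt, dif_pos hk, Pi.smul_apply, smul_eq_mul, add_zero]
  by_cases hk' : 2 ^ j - k - 1 < p
  · have hR : (fun x => phiLeft (fun y => φ (1 - y)) p ⟨2 ^ j - k - 1, hk'⟩ (-2 ^ j * x + 2 ^ j)) ∈
        cellSpace (localSpan φ) R := by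
      refine phiLeft_comp_mem_cellSpace
        (quasiMeasurePreserving_affine (neg_ne_zero.2 h2) (2 ^ j)) (fun i => ?_) _
      refine edge_comp_mem_cellSpace (fun u hu => ?_) (fun l => ?_) i
      · rw [show (fun x : ℝ => -2 ^ j * x + 2 ^ j) ⁻¹' Ici 0 = Iic 1 by
          ext x
          rw [mem_preimage, mem_Ici, mem_Iic, ← sub_nonneg (b := x),
            ← mul_nonneg_iff_of_pos_left h2' (b := 1 - x)]
          ring_nf]
        exact cellSpace_indicator_Iic hu
      -- The mirror image and the reflected generator `φ(1 - ·)` cancel, leaving an ordinary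
      -- translate of `φ(2^j ·)`.
      · have h := hV.translate_mem_cellSpace hj (1 - 2 ^ j - l)
        push_cast at h
        refine (congrArg (· ∈ cellSpace (localSpan φ) R) ?_).mp h
        funext x
        congr 1
        ring
    refine (congrArg (· ∈ cellSpace (localSpan φ) R) ?_).mp
      ((cellSpace (localSpan φ) R).smul_mem (((2 : ℝ) ^ ((j : ℝ) / 2) : ℝ) : ℂ) hR)
    funext x
    rw [phiInt, dif_neg hk, dif_pos hk', Pi.smul_apply, smul_eq_mul, phiRight]
    congr 2
    ring
  · have h := hV.dyadic_mem_cellSpace hV.memLp hV.scaling_mem (by omega : 0 + j ≤ R) k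
    refine (congrArg (· ∈ cellSpace (localSpan φ) R) ?_).mp h
    funext x
    rw [phiInt, dif_neg hk, dif_neg hk']

theorem IsMRA.VInt_le (hV : IsMRA V φ) [FiniteDimensional ℂ (localSpan φ)] (p : ℕ)
    {j R : ℕ} (hj : j ≤ R) : VInt φ p j ≤ cellH (localSpan φ) R := by
  refine Submodule.span_le.2 ?_
  rintro _ ⟨k, -, rfl⟩
  exact coe_toH_mem_cellSpace (hV.phiInt_mem_cellSpace p hj k)

theorem IsMRA.TInt_le (hV : IsMRA V φ) [FiniteDimensional ℂ (localSpan φ)] (p : ℕ)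
    {J R : ℕ} (hJR : J ≤ R) : TInt φ p J R ≤ cellH (localSpan φ) R := by
  refine sup_le (hV.VInt_le p hJR) (iSup₂_le fun j hj => ?_)
  exact inf_le_left.trans (hV.VInt_le p (Finset.mem_Ico.1 hj).2)

theorem finiteDimensional_VInt (φ : ℝ → ℂ) (p j : ℕ) : FiniteDimensional ℂ (VInt φ p j) := by
  refine FiniteDimensional.span_of_finite ℂ
    (((Finset.range (2 ^ j)).finite_toSet.image fun k : ℕ => toH (phiInt φ p j k)).subset ?_)
  rintro _ ⟨k, hk, rfl⟩
  exact ⟨k, by simpa using hk, rfl⟩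

theorem finiteDimensional_TInt (φ : ℝ → ℂ) (p J R : ℕ) : FiniteDimensional ℂ (TInt φ p J R) := by
  have := finiteDimensional_VInt φ p
  have : ∀ j, FiniteDimensional ℂ (WInt φ p j) := fun j =>
    Submodule.finiteDimensional_of_le inf_le_left
  rw [TInt, ← Finset.sup_eq_iSup]
  infer_instance

end MRA

/-! ### Admissibility and the reconstruction constant -/

section Reconstruction

variable {N : ℕ} {K δ : ℝ} {ω : Fin (N + 1) → ℝ} {T : Submodule ℂ H}

theorem isBoundedLinearMap_samplingOp (K : ℝ) (ω : Fin (N + 1) → ℝ) :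
    IsBoundedLinearMap ℂ (samplingOp K ω) := by
  have h : samplingOp K ω = ⇑(∑ i, (weight K ω i : ℂ) •
      (innerSL ℂ (expH (ω i))).smulRight (expH (ω i)) : H →L[ℂ] H) := by
    funext f
    rw [samplingOp_eq, _root_.sum_apply]
    refine Finset.sum_congr rfl fun i _ => ?_
    rw [_root_.smul_apply, ContinuousLinearMap.smulRight_apply, innerSL_apply_apply,
      inner_expH, smul_smul]
  rw [h]
  exact ContinuousLinearMap.isBoundedLinearMap _

theorem IsDense.isAdmissible (h : IsDense K δ ω) (hT : FiniteDimensional ℂ T) {C : ℝ} (hC : 0 < C)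
    (hlow : ∀ f ∈ T, C * ‖f‖ ^ 2 ≤ (⟪samplingOp K ω f, f⟫_ℂ).re) :
    IsAdmissible ω (samplingOp K ω) T where
  finite_dim := hT
  bounded_linear := isBoundedLinearMap_samplingOp K ω
  depends_on_samples f g hfg := by simp only [samplingOp_eq, hfg]
  self_adjoint f g := by
    rw [← inner_conj_symm f (samplingOp K ω g), inner_samplingOp, inner_samplingOp, map_sum]
    refine Finset.sum_congr rfl fun i _ => ?_
    rw [map_mul, map_mul, Complex.conj_conj, Complex.conj_ofReal, mul_comm (fhat g _)]
  cauchy_schwarz f g := by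
    rw [inner_samplingOp, re_inner_samplingOp, re_inner_samplingOp]
    refine (norm_sum_le _ _).trans (Real.le_sqrt_of_sq_le ?_)
    -- Discrete Cauchy–Schwarz, with each nonnegative weight split as `√μ · √μ`.
    have hcs := Finset.sum_mul_sq_le_sq_mul_sq Finset.univ
      (fun i => √(weight K ω i) * ‖fhat f (ω i)‖) fun i => √(weight K ω i) * ‖fhat g (ω i)‖
    simp only [mul_pow, Real.sq_sqrt (h.weight_nonneg _)] at hcs
    refine le_trans (le_of_eq ?_) hcs
    congr 1
    refine Finset.sum_congr rfl fun i _ => ?_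
    rw [norm_mul, norm_mul, RCLike.norm_conj, Complex.norm_real,
      Real.norm_of_nonneg (h.weight_nonneg i), mul_mul_mul_comm,
      Real.mul_self_sqrt (h.weight_nonneg i)]
  lower_bound := ⟨C, hC, hlow⟩

theorem C₂_le {S : H → H} {b : ℝ} (hb : 0 ≤ b) (hS : ∀ f, (⟪S f, f⟫_ℂ).re ≤ b * ‖f‖ ^ 2) :
    C₂ S ≤ b := by
  by_cases hbdd : BddBelow {C : ℝ | ∀ f : H, (⟪S f, f⟫_ℂ).re ≤ C * ‖f‖ ^ 2}
  · exact csInf_le hbdd hS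
  -- The real infimum of a set unbounded below is `0` by convention, so no nonzero element of `H`
  -- has to be exhibited.
  · rw [C₂, Real.sInf_of_not_bddBelow hbdd]
    exact hb

theorem le_C₁ {S : H → H} {a : ℝ} {f₀ : H} (hf₀ : f₀ ∈ T) (hne : f₀ ≠ 0)
    (hS : ∀ f ∈ T, a * ‖f‖ ^ 2 ≤ (⟪S f, f⟫_ℂ).re) : a ≤ C₁ S T := by
  refine le_csSup ⟨(⟪S f₀, f₀⟫_ℂ).re / ‖f₀‖ ^ 2, fun C hC => ?_⟩ hS
  rw [le_div_iff₀ (pow_pos (norm_pos_iff.2 hne) 2)]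
  exact hC f₀ hf₀

theorem reconConst_le {S : H → H} {a b : ℝ} (ha : 0 < a) (hb : 0 ≤ b)
    (hlow : ∀ f ∈ T, a ^ 2 * ‖f‖ ^ 2 ≤ (⟪S f, f⟫_ℂ).re)
    (hup : ∀ f, (⟪S f, f⟫_ℂ).re ≤ b ^ 2 * ‖f‖ ^ 2) : reconConst S T ≤ b / a := by
  rw [reconConst]
  refine Real.sqrt_le_iff.2 ⟨by positivity, ?_⟩
  by_cases hT : T = ⊥
  -- For the zero space every constant is admissible; the supremum defaults to `0`, and division by
  -- it makes the reconstruction constant `0`.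
  · have hset : {C : ℝ | ∀ f ∈ T, C * ‖f‖ ^ 2 ≤ (⟪S f, f⟫_ℂ).re} = univ := by
      refine eq_univ_of_forall fun C f hf => ?_
      rw [hT, Submodule.mem_bot] at hf
      simp [hf]
    have h0 : C₁ S T = 0 := by rw [C₁, hset, Real.sSup_univ]
    rw [h0, div_zero]
    positivity
  · obtain ⟨f₀, hf₀, hne⟩ := Submodule.exists_mem_ne_zero_of_ne_bot hT
    have h1 := le_C₁ hf₀ hne hlow
    have h2 := C₂_le (sq_nonneg b) hup
    rw [div_pow]
    exact div_le_div₀ (by positivity) h2 (by positivity) h1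

end Reconstruction

/-- Stable reconstruction in any subspace of `H` whose elements are, on each dyadic interval of
length `2^{-R}`, scaled copies of elements of a fixed finite-dimensional space. -/
theorem exists_reconstruction_constant (E : Submodule ℂ UnitL2) [FiniteDimensional ℂ E] {ε : ℝ}
    (hε : 0 < ε) : ∃ c₀ : ℝ, 0 < c₀ ∧ ∀ (R : ℕ) (T : Submodule ℂ H), FiniteDimensional ℂ T →
      T ≤ cellH E R → ∀ (N : ℕ) (K δ : ℝ) (ω : Fin (N + 1) → ℝ), IsDense K δ ω → ε < 1 - δ →
        c₀ * 2 ^ R ≤ K → IsAdmissible ω (samplingOp K ω) T ∧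
          reconConst (samplingOp K ω) T ≤ (1 + δ) / (1 - δ - ε) := by
  obtain ⟨M, hM⟩ := exists_frequency_bound E hε
  -- The extra `1` absorbs the `1/2` lost at the ends of the covered frequency interval, since `2^R
  -- ≥ 1`.
  refine ⟨M + 1, by positivity, fun R T hfin hT N K δ ω hω hεδ hK => ?_⟩
  have hδ := hω.delta_pos
  have h2 : (1 : ℝ) ≤ 2 ^ R := one_le_pow₀ one_le_two
  have hKM : 2 ^ R * (M : ℝ) ≤ K - 1 / 2 := by linarith
  have hM0 : (0 : ℝ) ≤ 2 ^ R * M := by positivity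
  have hlow : ∀ f ∈ T, (1 - ε - δ) ^ 2 * ‖f‖ ^ 2 ≤ (⟪samplingOp K ω f, f⟫_ℂ).re := by
    intro f hf
    refine hω.le_samplingOp (by linarith) (by linarith) f ?_
    have he := energy_of_cells hM (n := 2 ^ R) (by positivity) f fun m => by
      have := (hT hf m).1
      push_cast at this ⊢
      exact this
    push_cast at he
    -- Concentration supplies the fraction `1 - ε`, while the sampling bound wants a square; taking
    -- `s = 1 - ε` loses a little but gives the stated denominator.
    have hs : (1 - ε) ^ 2 ≤ 1 - ε := by nlinarith
    calc (1 - ε) ^ 2 * ‖f‖ ^ 2 ≤ (1 - ε) * ‖f‖ ^ 2 := by gcongr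
      _ ≤ _ := he
      _ ≤ _ := intervalIntegral.integral_mono_interval (by linarith) (by linarith) hKM
          (.of_forall fun _ => by positivity)
          (((continuous_fhat f).norm.pow 2).intervalIntegrable _ _)
  have hpos : 0 < 1 - ε - δ := by linarith
  refine ⟨hω.isAdmissible hfin (pow_pos hpos 2) hlow, ?_⟩
  rw [sub_right_comm]
  exact reconConst_le hpos (by linarith) hlow hω.samplingOp_le

end NUGS

end

theorem theorem5p4 (V : ℤ → Submodule ℂ NUGS.L2R) (φ : ℝ → ℂ) (hV : NUGS.IsMRA V φ)
    (p : ℕ) (hsupp : Function.support φ ⊆ Set.Icc (-(p : ℝ) + 1) p)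
    (c α : ℝ) (hα : 1 / 2 < α) (hdecay : ∀ ω : ℝ, ‖𝓕 φ ω‖ ≤ c / (1 + |ω|) ^ α) :
    (∀ (ψ : ℝ → ℂ), NUGS.IsWavelet V ψ → ∀ ι : ℕ, ι = 0 ∨ ι = 1 →
      ∀ ε : ℝ, 0 < ε → ∃ c₀ : ℝ, 0 < c₀ ∧
        ∀ J R : ℕ, J ≤ R →
        ∀ (N : ℕ) (K δ : ℝ) (ω : Fin (N + 1) → ℝ), NUGS.IsDense K δ ω → ε < 1 - δ →
          c₀ * 2 ^ R ≤ K →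
          NUGS.IsAdmissible ω (NUGS.samplingOp K ω) (NUGS.TFold φ ψ ι J R) ∧
          NUGS.reconConst (NUGS.samplingOp K ω) (NUGS.TFold φ ψ ι J R) ≤
            (1 + δ) / (1 - δ - ε)) ∧
    (∀ ε : ℝ, 0 < ε → ∃ c₀ : ℝ, 0 < c₀ ∧
        ∀ J R : ℕ, 2 * p ≤ 2 ^ J → J ≤ R →
        ∀ (N : ℕ) (K δ : ℝ) (ω : Fin (N + 1) → ℝ), NUGS.IsDense K δ ω → ε < 1 - δ →
          c₀ * 2 ^ R ≤ K →
          NUGS.IsAdmissible ω (NUGS.samplingOp K ω) (NUGS.TInt φ p J R) ∧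
          NUGS.reconConst (NUGS.samplingOp K ω) (NUGS.TInt φ p J R) ≤
            (1 + δ) / (1 - δ - ε)) := by
  have hA : Function.support φ ⊆ Icc (-(p : ℝ)) p :=
    hsupp.trans (Icc_subset_Icc_left (by linarith))
  have := NUGS.finiteDimensional_localSpan hA
  refine ⟨fun ψ hψ ι _ ε hε => ?_, fun ε hε => ?_⟩
  -- The constant is fixed by `localSpan φ` and `ε` before any level or sampling set is chosen.
  · obtain ⟨c₀, hc₀, h⟩ := NUGS.exists_reconstruction_constant (NUGS.localSpan φ) hε
    exact ⟨c₀, hc₀, fun J R hJR => h R _ (NUGS.finiteDimensional_TFold φ ψ ι J R)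
      (hV.TFold_le hA hψ ι hJR)⟩
  · obtain ⟨c₀, hc₀, h⟩ := NUGS.exists_reconstruction_constant (NUGS.localSpan φ) hε
    exact ⟨c₀, hc₀, fun J R _ hJR => h R _ (NUGS.finiteDimensional_TInt φ p J R)
      (hV.TInt_le p hJR)⟩
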